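/- Let $d_A,d_B\ge 1$ be integers, $d=d_Ad_B$, and let $|\psi\rangle=U|\psi_0\rangle\in\mathbb C^{d_A}\otimes\mathbb C^{d_B}$ be a Haar-random pure state, i.e. $U$ is distributed according to the Haar probability measure on the unitary group $U(d)$ and $\psi_0$ is any fixed unit vector. Put $\rho_A=\mathrm{Tr}_B|\psi\rangle\langle\psi|$ and let $$\mathcal F_A=\mathrm{Tr}(\rho_A^3)-\big(\mathrm{Tr}(\rho_A^2)\big)^2$$ be the linear Rényi spread. Then $\mathcal F_A$ is square-integrable and the following hold. 1. The mean is $$\mathbb E[\mathcal F_A]=\frac{(d_A^2-1)(d_B^2-1)}{(d+1)(d+2)(d+3)}.$$ It is $\Theta(1/d)$ for $d_A,d_B\ge2$: there are absolute constants $c,C>0$ with $c/d\le\mathbb E[\mathcal F_A]\le C/d$ for all $d_A,d_B\ge 2$. 2. The variance is $$\mathrm{Var}(\mathcal F_A)=\frac{(d_A^2-1)(d_B^2-1)\,P(d_A,d_B)}{(d+1)^2(d+2)^2(d+3)^2(d+4)(d+5)(d+6)(d+7)},$$ where $$\begin{aligned}P(a,b)={}&2a^6b^4+7a^5b^3(b^2-2)+a^4b^2(2b^4-5b^2-62)-7a^3b(2b^4+11b^2-26)\\&+a^2(-62b^4+413b^2+588)+2ab(91b^2+683)+84(7b^2+2).\end{aligned}$$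 It is $\Theta(1/d^3)$ for local dimensions of comparable size: there is an absolute constant $c>0$ with $\mathrm{Var}(\mathcal F_A)\ge c/d^3$ for all $d_A,d_B\ge2$, and for every $\kappa\ge1$ there is a constant $C_\kappa>0$ with $\mathrm{Var}(\mathcal F_A)\le C_\kappa/d^3$ for all $d_A,d_B\ge2$ with $d_A\le\kappa d_B$ and $d_B\le\kappa d_A$. 3. For two qubits, $d_A=d_B=2$, the law of $\mathcal F_A$ is absolutely continuous with respect to Lebesgue measure; it is concentrated on $(0,1/16)$ and has there the density $$p(f)=3\sqrt2\left(\frac{\sqrt{(\sqrt{1-16f}-1)(16f-1)}}{1-16f}+\sqrt{\frac1{\sqrt{1-16f}}+\frac1{1-16f}}\right).$$ -/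

import Mathlib

open MeasureTheory ProbabilityTheory

/-- The unitary group `U(n)` carries its Borel σ-algebra. -/
noncomputable instance unitaryGroupMeasurableSpace (n : Type*) [Fintype n] [DecidableEq n] :
    MeasurableSpace (Matrix.unitaryGroup n ℂ) :=
  borel _

instance unitaryGroupBorelSpace (n : Type*) [Fintype n] [DecidableEq n] :
    BorelSpace (Matrix.unitaryGroup n ℂ) :=
  ⟨rfl⟩

instance unitaryGroupCompactSpace (n : Type*) [Fintype n] [DecidableEq n] :
    CompactSpace (Matrix.unitaryGroup n ℂ) := by
  have hclosed : IsClosed (Matrix.unitaryGroup n ℂ : Set (Matrix n n ℂ)) := by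
    have h : (Matrix.unitaryGroup n ℂ : Set (Matrix n n ℂ))
        = {A : Matrix n n ℂ | A * star A = 1} := by
      ext A
      exact Matrix.mem_unitaryGroup_iff
    rw [h]
    exact isClosed_eq (by fun_prop) continuous_const
  have hK : IsCompact {A : Matrix n n ℂ | ∀ i, A i ∈ {v : n → ℂ | ∀ j,
      v j ∈ Metric.closedBall (0 : ℂ) 1}} :=
    isCompact_pi_infinite fun _ => isCompact_pi_infinite fun _ => isCompact_closedBall _ _
  refine isCompact_iff_compactSpace.mp (hK.of_isClosed_subset hclosed ?_)
  intro A hA i j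
  simpa using entry_norm_bound_of_unitary hA i j

noncomputable section

/-- The Haar probability measure on the unitary group `U(n)`. -/
def haarUnitary (n : Type*) [Fintype n] [DecidableEq n] :
    Measure (Matrix.unitaryGroup n ℂ) :=
  Measure.haarMeasure ⊤

/-- Vectors of `ℂ^{d_A} ⊗ ℂ^{d_B}`, written in the product basis `e_i ⊗ f_k`. -/
abbrev BipartiteSpace (dA dB : ℕ) : Type :=
  EuclideanSpace ℂ (Fin dA × Fin dB)

/-- The vector `U |ψ⟩`. -/
def unitaryAct {dA dB : ℕ} (U : Matrix.unitaryGroup (Fin dA × Fin dB) ℂ)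
    (ψ : BipartiteSpace dA dB) : BipartiteSpace dA dB :=
  WithLp.toLp 2 ((U : Matrix (Fin dA × Fin dB) (Fin dA × Fin dB) ℂ).mulVec ψ.ofLp)

/-- The operator `|ψ⟩⟨ψ|`. -/
def pureDensity {dA dB : ℕ} (ψ : BipartiteSpace dA dB) :
    Matrix (Fin dA × Fin dB) (Fin dA × Fin dB) ℂ :=
  Matrix.vecMulVec ψ.ofLp (star ψ.ofLp)

/-- The partial trace over the second factor. -/
def partialTraceB {dA dB : ℕ} (ρ : Matrix (Fin dA × Fin dB) (Fin dA × Fin dB) ℂ) :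
    Matrix (Fin dA) (Fin dA) ℂ :=
  Matrix.of fun i j => ∑ k, ρ (i, k) (j, k)

/-- The linear Rényi spread `F_A(ρ) = tr(ρ_A³) - (tr(ρ_A²))²`, with `ρ_A = Tr_B ρ`.
Both traces are real when `ρ` is Hermitian. -/
def linearRenyiSpread {dA dB : ℕ} (ρ : Matrix (Fin dA × Fin dB) (Fin dA × Fin dB) ℂ) : ℝ :=
  ((partialTraceB ρ ^ 3).trace).re - ((partialTraceB ρ ^ 2).trace).re ^ 2

/-- The random variable `U ↦ F_A(U |ψ₀⟩⟨ψ₀| U†)` on the unitary group. With `U` Haar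
distributed and `ψ₀` a unit vector, `U |ψ₀⟩` is a Haar-random pure state. -/
def spreadRV {dA dB : ℕ} (ψ₀ : BipartiteSpace dA dB)
    (U : Matrix.unitaryGroup (Fin dA × Fin dB) ℂ) : ℝ :=
  linearRenyiSpread (pureDensity (unitaryAct U ψ₀))

/-- The Haar expectation of the linear Rényi spread, with fiducial state `ψ₀`. -/
def spreadMean {dA dB : ℕ} (ψ₀ : BipartiteSpace dA dB) : ℝ :=
  ∫ U, spreadRV ψ₀ U ∂(haarUnitary (Fin dA × Fin dB))

/-- The Haar variance of the linear Rényi spread, with fiducial state `ψ₀`. -/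
def spreadVariance {dA dB : ℕ} (ψ₀ : BipartiteSpace dA dB) : ℝ :=
  variance (spreadRV ψ₀) (haarUnitary (Fin dA × Fin dB))

/-- The polynomial in `a = d_A`, `b = d_B` in the numerator of the variance. -/
def variancePoly (a b : ℝ) : ℝ :=
  2 * a ^ 6 * b ^ 4 + 7 * a ^ 5 * b ^ 3 * (b ^ 2 - 2)
    + a ^ 4 * b ^ 2 * (2 * b ^ 4 - 5 * b ^ 2 - 62)
    - 7 * a ^ 3 * b * (2 * b ^ 4 + 11 * b ^ 2 - 26)
    + a ^ 2 * (-62 * b ^ 4 + 413 * b ^ 2 + 588)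
    + 2 * a * b * (91 * b ^ 2 + 683)
    + 84 * (7 * b ^ 2 + 2)

/-- The density formula for two qubits, used for `0 < f < 1/16`. -/
def twoQubitDensity (f : ℝ) : ℝ :=
  3 * √2 * (√((√(1 - 16 * f) - 1) * (16 * f - 1)) / (1 - 16 * f)
    + √(1 / √(1 - 16 * f) + 1 / (1 - 16 * f)))

end

/-! Write the random vector as a `dA × dB` matrix `G`, so that `W = G G*` is the reduced state, and
put `p_k = tr W^k`. The spread is `p_3 - p_2²`, so mean and variance need finitely many Haar moments
of products of the `p_k`. These come from loop (Schwinger–Dyson) equations rather than from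
Weingarten calculus.

Invariance of Haar measure under one-parameter subgroups makes the expectation of every Lie
derivative along a skew-adjoint matrix vanish; complex linearity extends this to all matrices
(`haarExpect_linearFlow`). Since `|z|² = 1` on the orbit, this becomes an integration by parts on
the sphere (`haarExpect_pderiv`). Applied to the vector field `G ↦ W^m G`, whose divergence is again
a polynomial in the `p_k`, it gives `haarExpect_loop`: the moment of `p_(m+1) F` in terms of moments
of lower degree. With `p_1 = 1` the system for the moments up to `p_2^4` is triangular. Its solution
involves only `s = dA + dB` and `d = dA dB`, and `(d + 1)² - s² = (dA² - 1)(dB² - 1)` explains the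
common factor of mean and variance (`variance_of_moment_system`).

For two qubits, `W` is a 2 × 2 matrix of trace one, hence `p_3 = (3 p_2 - 1) / 2`, and the loop
equations close up into a recursion for the moments of the purity alone. The variable `(1 + u²) /
2`, with `u` of density `3u²` on `(0, 1)`, obeys the same recursion. Bounded laws are determined by
their moments, so the purity has this law (`map_purityRV`) and the spread is distributed as `u² (1 -
u²) / 4`. The two monotone branches of this function produce the two terms of the density
(`map_schmidtGapLaw`). -/

set_option linter.unusedSectionVars false

open MvPolynomial in
/-- Chain rule: a curve whose coordinates move according to a derivation `D` of the polynomial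
ring transports every polynomial according to `D`. -/
theorem hasDerivAt_eval_of_derivation {σ : Type*}
    (D : Derivation ℂ (MvPolynomial σ ℂ) (MvPolynomial σ ℂ)) (γ : ℝ → σ → ℂ) (t : ℝ)
    (h : ∀ s, HasDerivAt (fun t => γ t s) (eval (γ t) (D (X s))) t) (p : MvPolynomial σ ℂ) :
    HasDerivAt (fun t => eval (γ t) p) (eval (γ t) (D p)) t := by
  induction p using MvPolynomial.induction_on with
  | C a => simpa using hasDerivAt_const t a
  | add p q hp hq =>
    simp only [map_add]
    exact hp.add hq
  | mul_X p s hp =>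
    simp only [map_mul, eval_X, Derivation.leibniz, smul_eq_mul, map_add]
    refine (hp.mul (h s)).congr_deriv ?_
    ring

/-- The point with holomorphic coordinates `v` and antiholomorphic coordinates `conj v`. -/
def conjCoords {n : Type*} (v : n → ℂ) : n ⊕ n → ℂ :=
  Sum.elim v (star v)

instance haarUnitary_isProbabilityMeasure (n : Type*) [Fintype n] [DecidableEq n] :
    IsProbabilityMeasure (haarUnitary n) :=
  ⟨Measure.haarMeasure_self⟩

instance haarUnitary_isMulLeftInvariant (n : Type*) [Fintype n] [DecidableEq n] :
    (haarUnitary n).IsMulLeftInvariant := by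
  unfold haarUnitary
  infer_instance

/-! ### Haar expectation of polynomials and integration by parts on the sphere. -/

section Expectation

variable {n : Type*} [Fintype n] [DecidableEq n]

theorem continuous_eval_conjCoords_mulVec (v : n → ℂ) (p : MvPolynomial (n ⊕ n) ℂ) :
    Continuous fun U : Matrix.unitaryGroup n ℂ =>
      MvPolynomial.eval (conjCoords (U.1.mulVec v)) p := by
  refine (MvPolynomial.continuous_eval p).comp (continuous_pi fun s => ?_)
  have hU : Continuous fun U : Matrix.unitaryGroup n ℂ => U.1.mulVec v := by fun_prop
  rcases s with i | i
  · exact (continuous_apply i).comp hU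
  · exact ((continuous_apply i).comp hU).star

theorem integrable_haarUnitary_of_continuous {E : Type*} [NormedAddCommGroup E]
    [SecondCountableTopologyEither (Matrix.unitaryGroup n ℂ) E]
    {f : Matrix.unitaryGroup n ℂ → E} (hf : Continuous f) : Integrable f (haarUnitary n) := by
  obtain ⟨C, hC⟩ := isCompact_univ.exists_bound_of_continuousOn hf.continuousOn
  exact Integrable.of_bound hf.aestronglyMeasurable C (.of_forall fun U => hC U trivial)

/-- The Haar expectation of a polynomial in the coordinates of `U v` and their conjugates. -/
noncomputable def haarExpect (v : n → ℂ) : MvPolynomial (n ⊕ n) ℂ →ₗ[ℂ] ℂ where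
  toFun p := ∫ U : Matrix.unitaryGroup n ℂ,
    MvPolynomial.eval (conjCoords (U.1.mulVec v)) p ∂haarUnitary n
  map_add' p q := by
    simp only [map_add]
    exact integral_add (integrable_haarUnitary_of_continuous
      (continuous_eval_conjCoords_mulVec v p)) (integrable_haarUnitary_of_continuous
      (continuous_eval_conjCoords_mulVec v q))
  map_smul' c p := by
    simp only [MvPolynomial.smul_eval, RingHom.id_apply, smul_eq_mul]
    exact integral_const_mul _ _

/-- The derivation generated by the infinitesimal linear transformation `A` of the coordinates,
acting on the conjugate coordinates as if `A` were skew-adjoint. -/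
noncomputable def linearFlow : Matrix n n ℂ →ₗ[ℂ]
    Derivation ℂ (MvPolynomial (n ⊕ n) ℂ) (MvPolynomial (n ⊕ n) ℂ) where
  toFun A := MvPolynomial.mkDerivation ℂ (Sum.elim
    (fun k => ∑ j, MvPolynomial.C (A k j) * MvPolynomial.X (Sum.inl j))
    (fun k => -∑ j, MvPolynomial.C (A j k) * MvPolynomial.X (Sum.inr j)))
  map_add' A B := by
    refine MvPolynomial.derivation_ext fun s => ?_
    rcases s with i | i <;> simp [add_mul, Finset.sum_add_distrib, add_comm]
  map_smul' c A := by
    refine MvPolynomial.derivation_ext fun s => ?_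
    rcases s with i | i <;> simp [mul_assoc, Finset.mul_sum, MvPolynomial.smul_eq_C_mul]

theorem linearFlow_X_inl (A : Matrix n n ℂ) (i : n) :
    linearFlow A (MvPolynomial.X (Sum.inl i)) =
      ∑ j, MvPolynomial.C (A i j) * MvPolynomial.X (Sum.inl j) := by
  simp [linearFlow]

theorem linearFlow_X_inr (A : Matrix n n ℂ) (i : n) :
    linearFlow A (MvPolynomial.X (Sum.inr i)) =
      -∑ j, MvPolynomial.C (A j i) * MvPolynomial.X (Sum.inr j) := by
  simp [linearFlow]

/-- Skew-adjoint matrices exponentiate to differentiable one-parameter unitary groups. -/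
theorem exists_unitary_flow (A : Matrix n n ℂ) (hA : A.conjTranspose = -A) :
    ∃ V : ℝ → Matrix.unitaryGroup n ℂ, V 0 = 1 ∧
      ∀ t i j, HasDerivAt (fun t => (V t).1 i j) ((A * (V t).1) i j) t := by
  have hU : ∀ t : ℝ, NormedSpace.exp (t • A) ∈ Matrix.unitaryGroup n ℂ := by
    intro t
    rw [Matrix.mem_unitaryGroup_iff, Matrix.star_eq_conjTranspose, ← Matrix.exp_conjTranspose,
      Matrix.conjTranspose_smul, hA, ← Matrix.exp_add_of_commute]
    · simp
    · simp
  refine ⟨fun t => ⟨NormedSpace.exp (t • A), hU t⟩, ?_, fun t i j => ?_⟩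
  · ext1
    simp
  -- The choice of norm is immaterial in finite dimension; it only serves to differentiate the
  -- exponential.
  · let _ : NormedRing (Matrix n n ℂ) := Matrix.linftyOpNormedRing
    let _ : NormedAlgebra ℝ (Matrix n n ℂ) := Matrix.linftyOpNormedAlgebra
    have h := hasDerivAt_exp_smul_const' (𝕂 := ℝ) A t
    exact (LinearMap.toContinuousLinearMap
      (Matrix.entryLinearMap ℝ ℂ i j)).hasFDerivAt.comp_hasDerivAt t h

theorem haarExpect_linearFlow_of_skew (v : n → ℂ) (A : Matrix n n ℂ)
    (hA : A.conjTranspose = -A) (p : MvPolynomial (n ⊕ n) ℂ) :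
    haarExpect v (linearFlow A p) = 0 := by
  obtain ⟨V, hV0, hV⟩ := exists_unitary_flow A hA
  -- Skew-adjointness is what makes the true motion of the conjugate coordinates agree with the
  -- ℂ-linear formula built into `linearFlow`.
  have hA' : ∀ i j, star (A i j) = - A j i := fun i j => by
    have := congrFun (congrFun hA j) i
    simpa using this
  have hcoord : ∀ (U : Matrix.unitaryGroup n ℂ) (t : ℝ) (i : n),
      HasDerivAt (fun t => ((V t * U).1.mulVec v) i) ((A.mulVec ((V t * U).1.mulVec v)) i) t := by
    intro U t i
    have h1 : ∀ t, ((V t * U).1.mulVec v) i = ∑ j, (V t).1 i j * (U.1.mulVec v) j := fun t => by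
      rw [Submonoid.coe_mul, ← Matrix.mulVec_mulVec]; rfl
    have h2 : (A.mulVec ((V t * U).1.mulVec v)) i
        = ∑ j, (A * (V t).1) i j * (U.1.mulVec v) j := by
      rw [Submonoid.coe_mul, ← Matrix.mulVec_mulVec, Matrix.mulVec_mulVec]; rfl
    simp only [h1, h2]
    exact HasDerivAt.fun_sum fun j _ => (hV t i j).mul_const _
  have hdiff : ∀ (U : Matrix.unitaryGroup n ℂ) (t : ℝ),
      HasDerivAt (fun t => MvPolynomial.eval (conjCoords ((V t * U).1.mulVec v)) p)
        (MvPolynomial.eval (conjCoords ((V t * U).1.mulVec v)) (linearFlow A p)) t := by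
    intro U t
    refine hasDerivAt_eval_of_derivation _ _ _ (fun s => ?_) p
    rcases s with i | i
    · rw [linearFlow_X_inl]
      simpa [conjCoords, Matrix.mulVec, dotProduct] using hcoord U t i
    · rw [linearFlow_X_inr]
      refine (hcoord U t i).star.congr_deriv ?_
      simp only [conjCoords, map_neg, map_sum, map_mul, MvPolynomial.eval_C,
        MvPolynomial.eval_X, Sum.elim_inr, Pi.star_apply]
      rw [Matrix.mulVec, dotProduct, star_sum, ← Finset.sum_neg_distrib]
      refine Finset.sum_congr rfl fun j _ => ?_
      rw [star_mul', hA']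
      ring
  obtain ⟨C, hC⟩ := isCompact_univ.exists_bound_of_continuousOn
    (continuous_eval_conjCoords_mulVec v (linearFlow A p)).continuousOn
  have hcont : ∀ (t : ℝ) (q : MvPolynomial (n ⊕ n) ℂ), Continuous fun U : Matrix.unitaryGroup n ℂ =>
      MvPolynomial.eval (conjCoords ((V t * U).1.mulVec v)) q := fun t q =>
    (continuous_eval_conjCoords_mulVec v q).comp (continuous_const.mul continuous_id)
  have key := (hasDerivAt_integral_of_dominated_loc_of_deriv_le (μ := haarUnitary n)
    (F := fun t U => MvPolynomial.eval (conjCoords ((V t * U).1.mulVec v)) p)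
    (F' := fun t U => MvPolynomial.eval (conjCoords ((V t * U).1.mulVec v)) (linearFlow A p))
    (bound := fun _ => C) (x₀ := (0 : ℝ)) (s := Set.univ) Filter.univ_mem
    (.of_forall fun t => (hcont t p).aestronglyMeasurable)
    (integrable_haarUnitary_of_continuous (hcont 0 p))
    (hcont 0 _).aestronglyMeasurable
    (.of_forall fun U t _ => hC _ trivial) (integrable_const C)
    (.of_forall fun U t _ => hdiff U t)).2
  -- By left invariance the expectation does not depend on `t`, so its derivative at `0`, computed
  -- under the integral sign in `key`, is zero.
  have hconst : (fun t => ∫ U, MvPolynomial.eval (conjCoords ((V t * U).1.mulVec v)) p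
      ∂haarUnitary n) = fun _ => haarExpect v p := by
    funext t
    exact integral_mul_left_eq_self
      (fun U : Matrix.unitaryGroup n ℂ => MvPolynomial.eval (conjCoords (U.1.mulVec v)) p) (V t)
  rw [hconst] at key
  have := key.unique (hasDerivAt_const _ _)
  simp only [hV0, one_mul] at this
  exact this

/-- `linearFlow` is complex linear in the matrix, and every matrix is a complex combination of the
skew-adjoint matrices `A - A*` and `i (A + A*)`. -/
theorem haarExpect_linearFlow (v : n → ℂ) (A : Matrix n n ℂ) (p : MvPolynomial (n ⊕ n) ℂ) :
    haarExpect v (linearFlow A p) = 0 := by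
  have h1 := haarExpect_linearFlow_of_skew v (A - A.conjTranspose) (by simp) p
  have h2 := haarExpect_linearFlow_of_skew v (Complex.I • (A + A.conjTranspose))
    (by simp [Matrix.conjTranspose_smul, add_comm]) p
  have hA : A = (1 / 2 : ℂ) • (A - A.conjTranspose) +
      (-Complex.I / 2) • (Complex.I • (A + A.conjTranspose)) := by
    rw [smul_smul, show -Complex.I / 2 * Complex.I = 1 / 2 by
      linear_combination (-1 / 2 : ℂ) * Complex.I_mul_I, ← smul_add]
    simp [← two_smul ℂ A, smul_smul]
  rw [hA, map_add, map_smul, map_smul, Derivation.add_apply, Derivation.smul_apply,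
    Derivation.smul_apply, map_add, map_smul, map_smul, h1, h2, smul_zero, smul_zero, add_zero]

/-- The Euler derivation in the conjugate coordinates. -/
noncomputable def conjEuler (n : Type*) :
    Derivation ℂ (MvPolynomial (n ⊕ n) ℂ) (MvPolynomial (n ⊕ n) ℂ) :=
  MvPolynomial.mkDerivation ℂ (Sum.elim 0 fun k => MvPolynomial.X (Sum.inr k))

theorem linearFlow_single (i j : n) (p : MvPolynomial (n ⊕ n) ℂ) :
    linearFlow (Matrix.single i j 1) p =
      MvPolynomial.X (Sum.inl j) * MvPolynomial.pderiv (Sum.inl i) p -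
        MvPolynomial.X (Sum.inr i) * MvPolynomial.pderiv (Sum.inr j) p := by
  have : linearFlow (Matrix.single i j (1 : ℂ)) =
      (MvPolynomial.X (Sum.inl j) : MvPolynomial (n ⊕ n) ℂ) •
        MvPolynomial.pderiv (R := ℂ) (Sum.inl i) -
      (MvPolynomial.X (Sum.inr i) : MvPolynomial (n ⊕ n) ℂ) •
        MvPolynomial.pderiv (R := ℂ) (Sum.inr j) := by
    refine MvPolynomial.derivation_ext fun s => ?_
    rcases s with k | k
    · rw [linearFlow_X_inl]
      by_cases h : i = k <;>
        simp [Matrix.single_apply, MvPolynomial.pderiv_X, h, eq_comm]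
    · rw [linearFlow_X_inr]
      by_cases h : j = k <;>
        simp [Matrix.single_apply, MvPolynomial.pderiv_X, h, eq_comm]
  rw [this]
  rfl

theorem conjEuler_eq_sum (p : MvPolynomial (n ⊕ n) ℂ) :
    conjEuler n p = ∑ j, MvPolynomial.X (Sum.inr j) * MvPolynomial.pderiv (Sum.inr j) p := by
  have : conjEuler n = ∑ j, (MvPolynomial.X (Sum.inr j) : MvPolynomial (n ⊕ n) ℂ) •
      MvPolynomial.pderiv (R := ℂ) (Sum.inr j) := by
    refine MvPolynomial.derivation_ext fun s => ?_
    rw [← Derivation.coeFnAddMonoidHom_apply, ← Derivation.coeFnAddMonoidHom_apply, map_sum,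
      Finset.sum_apply]
    rcases s with k | k <;>
      simp [conjEuler, MvPolynomial.pderiv_X, Pi.single_apply]
  rw [this, ← Derivation.coeFnAddMonoidHom_apply, map_sum, Finset.sum_apply]
  rfl

theorem sum_mul_star_mulVec (v : n → ℂ) (hv : ∑ i, v i * star (v i) = 1)
    (U : Matrix.unitaryGroup n ℂ) :
    ∑ i, (U.1.mulVec v) i * star ((U.1.mulVec v) i) = 1 := by
  have h : dotProduct (U.1.mulVec v) (star (U.1.mulVec v)) = dotProduct v (star v) := by
    rw [dotProduct_comm, Matrix.star_mulVec, ← Matrix.dotProduct_mulVec, Matrix.mulVec_mulVec]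
    have := Matrix.mem_unitaryGroup_iff'.1 U.2
    rw [Matrix.star_eq_conjTranspose] at this
    rw [this, Matrix.one_mulVec, dotProduct_comm]
  exact h.trans hv

/-- This allows `|z|² = 1` to be used inside an expectation. It is an identity of values on the
orbit, not of polynomials, so it may not be used under a derivation. -/
theorem haarExpect_congr (v : n → ℂ) {p q : MvPolynomial (n ⊕ n) ℂ}
    (h : ∀ U : Matrix.unitaryGroup n ℂ, MvPolynomial.eval (conjCoords (U.1.mulVec v)) p =
      MvPolynomial.eval (conjCoords (U.1.mulVec v)) q) :
    haarExpect v p = haarExpect v q :=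
  integral_congr_ae (.of_forall h)

/-- Integration by parts on the unit sphere of `ℂⁿ`. -/
theorem haarExpect_pderiv (v : n → ℂ) (hv : ∑ i, v i * star (v i) = 1) (i : n)
    (g : MvPolynomial (n ⊕ n) ℂ) :
    haarExpect v (MvPolynomial.pderiv (Sum.inl i) g) =
      ((Fintype.card n : ℂ) - 1) * haarExpect v (MvPolynomial.X (Sum.inr i) * g) +
        haarExpect v (conjEuler n (MvPolynomial.X (Sum.inr i) * g)) := by
  -- The flow of the matrix unit `E_ij` is `z_j ∂_i - z̄_i ∂̄_j`. Applied to `z̄_j g` and summed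
  -- over `j`, its first term yields `|z|² ∂_i g`, and the others yield multiples of `z̄_i g` and
  -- the conjugate Euler operator.
  have h0 : ∑ j, haarExpect v (linearFlow (Matrix.single i j 1)
      (MvPolynomial.X (Sum.inr j) * g)) = 0 :=
    Finset.sum_eq_zero fun j _ => haarExpect_linearFlow v _ _
  have h1 : haarExpect v ((∑ j, MvPolynomial.X (Sum.inl j) * MvPolynomial.X (Sum.inr j)) *
      MvPolynomial.pderiv (Sum.inl i) g) = haarExpect v (MvPolynomial.pderiv (Sum.inl i) g) := by
    refine haarExpect_congr v fun U => ?_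
    have := sum_mul_star_mulVec v hv U
    simp only [map_mul, map_sum, MvPolynomial.eval_X, conjCoords, Sum.elim_inl, Sum.elim_inr,
      Pi.star_apply, this, one_mul]
  rw [← map_sum] at h0
  have h2 : ∑ j, linearFlow (Matrix.single i j 1) (MvPolynomial.X (Sum.inr j) * g) =
      (∑ j, MvPolynomial.X (Sum.inl j) * MvPolynomial.X (Sum.inr j)) *
        MvPolynomial.pderiv (Sum.inl i) g -
      (((Fintype.card n : ℂ) - 1) • (MvPolynomial.X (Sum.inr i) * g) +
        conjEuler n (MvPolynomial.X (Sum.inr i) * g)) := by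
    have hX : conjEuler n (MvPolynomial.X (Sum.inr i)) = MvPolynomial.X (Sum.inr i) := by
      simp [conjEuler]
    have hj : ∀ j, linearFlow (Matrix.single i j 1) (MvPolynomial.X (Sum.inr j) * g) =
        MvPolynomial.X (Sum.inl j) * MvPolynomial.X (Sum.inr j) *
          MvPolynomial.pderiv (Sum.inl i) g - MvPolynomial.X (Sum.inr i) * g -
        MvPolynomial.X (Sum.inr i) *
          (MvPolynomial.X (Sum.inr j) * MvPolynomial.pderiv (Sum.inr j) g) := fun j => by
      rw [linearFlow_single, Derivation.leibniz, Derivation.leibniz, MvPolynomial.pderiv_X_self,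
        MvPolynomial.pderiv_X_of_ne (by simp)]
      simp only [smul_eq_mul]
      ring
    rw [Derivation.leibniz, hX, conjEuler_eq_sum, Finset.sum_congr rfl fun j _ => hj j]
    simp only [Finset.sum_sub_distrib, ← Finset.sum_mul, ← Finset.mul_sum, Finset.sum_const,
      Finset.card_univ, nsmul_eq_mul, smul_eq_mul, sub_smul, one_smul, Nat.cast_smul_eq_nsmul]
    ring
  rw [h2, map_sub, map_add, map_smul, h1, sub_eq_zero] at h0
  simpa using h0

end Expectation

/-! ### Derivations acting entrywise on matrices. -/

section MatrixDerivation

variable {R S : Type*} [CommSemiring R] [CommRing S] [Algebra R S]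

theorem Derivation.map_matrix_mul {l m n : Type*} [Fintype m] (D : Derivation R S S)
    (A : Matrix l m S) (B : Matrix m n S) :
    (A * B).map D = A.map D * B + A * B.map D := by
  ext i j
  simp only [Matrix.map_apply, Matrix.mul_apply, map_sum, Derivation.leibniz, smul_eq_mul,
    Matrix.add_apply, ← Finset.sum_add_distrib]
  exact Finset.sum_congr rfl fun k _ => by ring

/-- Because `D W` is itself a power of `W`, it commutes with `W`, and the noncommutative Leibniz sum
collapses to `l + 1` equal terms. -/
theorem Derivation.map_matrix_pow_succ {m : Type*} [Fintype m] [DecidableEq m]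
    (D : Derivation R S S) (W : Matrix m m S) (k : ℕ) (hD : W.map D = W ^ k) (l : ℕ) :
    (W ^ (l + 1)).map D = (l + 1) • W ^ (l + k) := by
  induction l with
  | zero => simp [hD]
  | succ l ih =>
    rw [pow_succ, D.map_matrix_mul, ih, hD, Matrix.smul_mul, ← pow_succ, ← pow_add,
      show l + k + 1 = l + 1 + k by ring, succ_nsmul _ (l + 1)]

theorem Derivation.map_trace {m : Type*} [Fintype m] (D : Derivation R S S) (W : Matrix m m S) :
    D W.trace = (W.map D).trace := by
  simp [Matrix.trace]

end MatrixDerivation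

/-! ### Loop equations for the power traces. -/

section LoopEquation

variable (ι κ : Type*) [Fintype ι] [Fintype κ] [DecidableEq ι] [DecidableEq κ]

/-- The matrix of coordinates of a bipartite vector. -/
noncomputable def coordMatrix : Matrix ι κ (MvPolynomial ((ι × κ) ⊕ (ι × κ)) ℂ) :=
  Matrix.of fun i a => MvPolynomial.X (Sum.inl (i, a))

/-- The adjoint of the matrix of coordinates of a bipartite vector. -/
noncomputable def conjCoordMatrix : Matrix κ ι (MvPolynomial ((ι × κ) ⊕ (ι × κ)) ℂ) :=
  Matrix.of fun a i => MvPolynomial.X (Sum.inr (i, a))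

/-- The reduced density matrix with polynomial entries. -/
noncomputable def reducedMatrix : Matrix ι ι (MvPolynomial ((ι × κ) ⊕ (ι × κ)) ℂ) :=
  coordMatrix ι κ * conjCoordMatrix ι κ

/-- The power sums of the eigenvalues of the reduced density matrix. -/
noncomputable def powerTrace (k : ℕ) : MvPolynomial ((ι × κ) ⊕ (ι × κ)) ℂ :=
  (reducedMatrix ι κ ^ k).trace

/-- The derivation sending the coordinate matrix `G` to `W ^ k * G`, with `W` the reduced density
matrix, and killing the conjugate coordinates. -/
noncomputable def loopDerivation (k : ℕ) : Derivation ℂ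
    (MvPolynomial ((ι × κ) ⊕ (ι × κ)) ℂ) (MvPolynomial ((ι × κ) ⊕ (ι × κ)) ℂ) :=
  MvPolynomial.mkDerivation ℂ (Sum.elim
    (fun x => (reducedMatrix ι κ ^ k * coordMatrix ι κ) x.1 x.2) 0)

theorem powerTrace_zero : powerTrace ι κ 0 = Fintype.card ι := by
  simp [powerTrace]

theorem loopDerivation_powerTrace (k l : ℕ) :
    loopDerivation ι κ k (powerTrace ι κ (l + 1)) = (l + 1) • powerTrace ι κ (l + k + 1) := by
  have h1 : (coordMatrix ι κ).map (loopDerivation ι κ k) =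
      reducedMatrix ι κ ^ k * coordMatrix ι κ := by
    ext i a
    simp [coordMatrix, loopDerivation]
  have h2 : (conjCoordMatrix ι κ).map (loopDerivation ι κ k) = 0 := by
    ext i a
    simp [conjCoordMatrix, loopDerivation]
  have h : (reducedMatrix ι κ).map (loopDerivation ι κ k) = reducedMatrix ι κ ^ (k + 1) := by
    conv_lhs => rw [reducedMatrix]
    rw [Derivation.map_matrix_mul, h1, h2, Matrix.mul_zero, add_zero, Matrix.mul_assoc,
      ← reducedMatrix, pow_succ]
  rw [powerTrace, Derivation.map_trace, Derivation.map_matrix_pow_succ _ _ _ h, Matrix.trace_smul]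
  rfl

/-- Each factor `W` is linear in the conjugate coordinates, so `W` is fixed by the Euler derivation
and `p_l` is homogeneous of degree `l`. -/
theorem conjEuler_powerTrace (l : ℕ) :
    conjEuler (ι × κ) (powerTrace ι κ l) = l • powerTrace ι κ l := by
  have h1 : (coordMatrix ι κ).map (conjEuler (ι × κ)) = 0 := by
    ext i a
    simp [coordMatrix, conjEuler]
  have h2 : (conjCoordMatrix ι κ).map (conjEuler (ι × κ)) = conjCoordMatrix ι κ := by
    ext i a
    simp [conjCoordMatrix, conjEuler]
  have h : (reducedMatrix ι κ).map (conjEuler (ι × κ)) = reducedMatrix ι κ ^ 1 := by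
    conv_lhs => rw [reducedMatrix]
    rw [Derivation.map_matrix_mul, h1, h2, Matrix.zero_mul, zero_add, ← reducedMatrix, pow_one]
  cases l with
  | zero => simp [powerTrace_zero]
  | succ l =>
    rw [powerTrace, Derivation.map_trace, Derivation.map_matrix_pow_succ _ _ _ h,
      Matrix.trace_smul]

theorem loopDerivation_eq_sum (k : ℕ) (F : MvPolynomial ((ι × κ) ⊕ (ι × κ)) ℂ) :
    loopDerivation ι κ k F = ∑ x : ι × κ, (reducedMatrix ι κ ^ k * coordMatrix ι κ) x.1 x.2 *
      MvPolynomial.pderiv (Sum.inl x) F := by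
  have : loopDerivation ι κ k = ∑ x : ι × κ, (reducedMatrix ι κ ^ k * coordMatrix ι κ) x.1 x.2 •
      MvPolynomial.pderiv (R := ℂ) (Sum.inl x) := by
    refine MvPolynomial.derivation_ext fun s => ?_
    rw [← Derivation.coeFnAddMonoidHom_apply, ← Derivation.coeFnAddMonoidHom_apply, map_sum,
      Finset.sum_apply]
    rcases s with k | k <;>
      simp [loopDerivation, MvPolynomial.pderiv_X, Pi.single_apply]
  rw [this, ← Derivation.coeFnAddMonoidHom_apply, map_sum, Finset.sum_apply]
  rfl

theorem trace_conjCoordMatrix_mul (r : ℕ) :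
    (conjCoordMatrix ι κ * (reducedMatrix ι κ ^ r * coordMatrix ι κ)).trace =
      powerTrace ι κ (r + 1) := by
  rw [Matrix.trace_mul_comm, Matrix.mul_assoc, ← reducedMatrix, ← pow_succ, powerTrace]

theorem map_pderiv_coordMatrix (x : ι × κ) :
    (coordMatrix ι κ).map (MvPolynomial.pderiv (R := ℂ) (Sum.inl x)) =
      Matrix.single x.1 x.2 (1 : MvPolynomial ((ι × κ) ⊕ (ι × κ)) ℂ) := by
  ext i a
  simp only [coordMatrix, Matrix.map_apply, Matrix.of_apply, MvPolynomial.pderiv_X,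
    Matrix.single_apply, Pi.single_apply, Sum.inl.injEq, Prod.ext_iff]
  simp only [eq_comm]

theorem map_pderiv_reducedMatrix (x : ι × κ) :
    (reducedMatrix ι κ).map (MvPolynomial.pderiv (R := ℂ) (Sum.inl x)) =
      Matrix.single x.1 x.2 (1 : MvPolynomial ((ι × κ) ⊕ (ι × κ)) ℂ) * conjCoordMatrix ι κ := by
  have h2 : (conjCoordMatrix ι κ).map (MvPolynomial.pderiv (R := ℂ) (Sum.inl x)) = 0 := by
    ext a i
    simp [conjCoordMatrix, MvPolynomial.pderiv_X]
  rw [reducedMatrix, Derivation.map_matrix_mul, map_pderiv_coordMatrix, h2, Matrix.mul_zero, add_zero]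

/-- The splitting rule of the loop equations: contracting a matrix unit cuts one trace into two. -/
theorem sum_mul_single_mul_apply {S : Type*} [CommRing S] (A : Matrix ι ι S) (B : Matrix κ κ S) :
    ∑ x : ι × κ, (A * Matrix.single x.1 x.2 (1 : S) * B) x.1 x.2 = A.trace * B.trace := by
  rw [Fintype.sum_prod_type, Matrix.trace, Matrix.trace, Finset.sum_mul_sum]
  refine Finset.sum_congr rfl fun i _ => Finset.sum_congr rfl fun a _ => ?_
  simp [Matrix.mul_apply, Matrix.single_apply, ite_and]

/-- Differentiating one factor of `W^m` leaves a matrix unit between two words in `W`, which then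
splits into two traces. The exponent `r` is free because the induction peels off the last `W` and
moves it to the right-hand word. -/
theorem sum_map_pderiv_pow_mul (m r : ℕ) :
    ∑ x : ι × κ, ((reducedMatrix ι κ ^ m).map (MvPolynomial.pderiv (R := ℂ) (Sum.inl x)) *
      (reducedMatrix ι κ ^ r * coordMatrix ι κ)) x.1 x.2 =
      ∑ j ∈ Finset.range m, powerTrace ι κ (m - 1 - j) * powerTrace ι κ (r + j + 1) := by
  induction m generalizing r with
  | zero =>
    refine Finset.sum_eq_zero fun x _ => ?_
    have : ((reducedMatrix ι κ ^ 0).map (MvPolynomial.pderiv (R := ℂ) (Sum.inl x))) = 0 := by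
      ext i j
      by_cases h : i = j <;> simp [h]
    rw [this, Matrix.zero_mul, Matrix.zero_apply]
  | succ m ih =>
    have h : ∀ x : ι × κ, ((reducedMatrix ι κ ^ (m + 1)).map
          (MvPolynomial.pderiv (R := ℂ) (Sum.inl x)) *
          (reducedMatrix ι κ ^ r * coordMatrix ι κ)) x.1 x.2 =
        ((reducedMatrix ι κ ^ m).map (MvPolynomial.pderiv (R := ℂ) (Sum.inl x)) *
          (reducedMatrix ι κ ^ (r + 1) * coordMatrix ι κ)) x.1 x.2 +
        (reducedMatrix ι κ ^ m * Matrix.single x.1 x.2 (1 : MvPolynomial ((ι × κ) ⊕ (ι × κ)) ℂ) *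
          (conjCoordMatrix ι κ * (reducedMatrix ι κ ^ r * coordMatrix ι κ))) x.1 x.2 := fun x => by
      rw [pow_succ, Derivation.map_matrix_mul, map_pderiv_reducedMatrix, pow_succ' _ r,
        Matrix.add_mul, Matrix.add_apply]
      simp only [Matrix.mul_assoc]
    rw [Finset.sum_congr rfl fun x _ => h x, Finset.sum_add_distrib, ih,
      sum_mul_single_mul_apply, trace_conjCoordMatrix_mul, Finset.sum_range_succ']
    refine congrArg₂ (· + ·) (Finset.sum_congr rfl fun j hj => ?_) rfl
    rw [show m + 1 - 1 - (j + 1) = m - 1 - j by omega, show r + 1 + j + 1 = r + (j + 1) + 1 by ring]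

/-- This is the divergence of the vector field `G ↦ W^m G`. The last term comes from differentiating
the final factor `G`. -/
theorem sum_pderiv_pow_mul_coordMatrix (m : ℕ) :
    ∑ x : ι × κ, MvPolynomial.pderiv (R := ℂ) (Sum.inl x)
      ((reducedMatrix ι κ ^ m * coordMatrix ι κ) x.1 x.2) =
      ∑ j ∈ Finset.range m, powerTrace ι κ (m - 1 - j) * powerTrace ι κ (j + 1) +
        Fintype.card κ • powerTrace ι κ m := by
  have h : ∀ x : ι × κ, MvPolynomial.pderiv (R := ℂ) (Sum.inl x)
      ((reducedMatrix ι κ ^ m * coordMatrix ι κ) x.1 x.2) =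
      ((reducedMatrix ι κ ^ m).map (MvPolynomial.pderiv (R := ℂ) (Sum.inl x)) *
        (reducedMatrix ι κ ^ 0 * coordMatrix ι κ) :
        Matrix ι κ (MvPolynomial ((ι × κ) ⊕ (ι × κ)) ℂ)) x.1 x.2 +
      (reducedMatrix ι κ ^ m * Matrix.single x.1 x.2 (1 : MvPolynomial ((ι × κ) ⊕ (ι × κ)) ℂ) *
        (1 : Matrix κ κ (MvPolynomial ((ι × κ) ⊕ (ι × κ)) ℂ))) x.1 x.2 := fun x => by
    rw [← Matrix.map_apply (f := MvPolynomial.pderiv (R := ℂ) (Sum.inl x)),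
      Derivation.map_matrix_mul, map_pderiv_coordMatrix, pow_zero, Matrix.one_mul, Matrix.mul_one,
      Matrix.add_apply]
  rw [Finset.sum_congr rfl fun x _ => h x, Finset.sum_add_distrib, sum_map_pderiv_pow_mul,
    sum_mul_single_mul_apply, Matrix.trace_one, ← powerTrace, nsmul_eq_mul,
    mul_comm (powerTrace _ _ m)]
  simp only [zero_add]

/-- The loop equation for the moments of the power traces of the reduced density matrix. -/
theorem haarExpect_loop (v : ι × κ → ℂ) (hv : ∑ x, v x * star (v x) = 1) (m : ℕ)
    (F : MvPolynomial ((ι × κ) ⊕ (ι × κ)) ℂ) :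
    ((Fintype.card ι : ℂ) * Fintype.card κ - 1) * haarExpect v (powerTrace ι κ (m + 1) * F) +
        haarExpect v (conjEuler (ι × κ) (powerTrace ι κ (m + 1) * F)) =
      haarExpect v ((∑ j ∈ Finset.range m, powerTrace ι κ (m - 1 - j) * powerTrace ι κ (j + 1) +
        Fintype.card κ • powerTrace ι κ m) * F) + haarExpect v (loopDerivation ι κ m F) := by
  have h1 : powerTrace ι κ (m + 1) * F = ∑ x : ι × κ, MvPolynomial.X (Sum.inr x) *
      ((reducedMatrix ι κ ^ m * coordMatrix ι κ) x.1 x.2 * F) := by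
    rw [← trace_conjCoordMatrix_mul, Matrix.trace_mul_comm, Matrix.trace, Finset.sum_mul,
      Fintype.sum_prod_type]
    refine Finset.sum_congr rfl fun i _ => ?_
    rw [Matrix.diag_apply, Matrix.mul_apply, Finset.sum_mul]
    refine Finset.sum_congr rfl fun a _ => ?_
    simp only [conjCoordMatrix, Matrix.of_apply]
    ring
  -- Integration by parts in every coordinate `x`, with `g` the component `(W^m G)_x` times `F`; by
  -- `h1` the boundary-type terms add up to `p_(m+1) F`.
  have h2 := Finset.sum_congr (rfl : (Finset.univ : Finset (ι × κ)) = _) fun x _ =>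
    haarExpect_pderiv v hv x ((reducedMatrix ι κ ^ m * coordMatrix ι κ) x.1 x.2 * F)
  rw [← map_sum, Finset.sum_add_distrib, ← Finset.mul_sum, ← map_sum, ← map_sum, ← map_sum,
    ← h1, Fintype.card_prod, Nat.cast_mul] at h2
  rw [← h2, ← map_add, ← sum_pderiv_pow_mul_coordMatrix, loopDerivation_eq_sum, Finset.sum_mul,
    ← Finset.sum_add_distrib]
  congr 1
  refine Finset.sum_congr rfl fun x _ => ?_
  rw [Derivation.leibniz]
  simp only [smul_eq_mul]
  ring

end LoopEquation

/-! ### The individual moment recursions. -/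

section Moments

variable {ι κ : Type*} [Fintype ι] [Fintype κ] [DecidableEq ι] [DecidableEq κ]
  (v : ι × κ → ℂ)

theorem eval_powerTrace_one (hv : ∑ x, v x * star (v x) = 1)
    (U : Matrix.unitaryGroup (ι × κ) ℂ) :
    MvPolynomial.eval (conjCoords (U.1.mulVec v)) (powerTrace ι κ 1) = 1 := by
  rw [← sum_mul_star_mulVec v hv U, Fintype.sum_prod_type]
  simp [powerTrace, reducedMatrix, Matrix.trace, Matrix.mul_apply, coordMatrix, conjCoordMatrix,
    conjCoords]

theorem haarExpect_powerTrace_one_mul (hv : ∑ x, v x * star (v x) = 1)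
    (F : MvPolynomial ((ι × κ) ⊕ (ι × κ)) ℂ) :
    haarExpect v (powerTrace ι κ 1 * F) = haarExpect v F :=
  haarExpect_congr v fun U => by rw [map_mul, eval_powerTrace_one v hv, one_mul]

theorem haarExpect_one : haarExpect v 1 = 1 := by
  simp [haarExpect]

theorem haarExpect_powerTrace_two_mul (hv : ∑ x, v x * star (v x) = 1)
    (F : MvPolynomial ((ι × κ) ⊕ (ι × κ)) ℂ) :
    ((Fintype.card ι : ℂ) * Fintype.card κ + 1) * haarExpect v (powerTrace ι κ 2 * F) +
        haarExpect v (powerTrace ι κ 2 * conjEuler (ι × κ) F) =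
      ((Fintype.card ι : ℂ) + Fintype.card κ) * haarExpect v F +
        haarExpect v (loopDerivation ι κ 1 F) := by
  have h := haarExpect_loop ι κ v hv 1 F
  have e1 : conjEuler (ι × κ) (powerTrace ι κ (1 + 1) * F) =
      powerTrace ι κ 2 * conjEuler (ι × κ) F + (2 : ℂ) • (powerTrace ι κ 2 * F) := by
    rw [Derivation.leibniz, conjEuler_powerTrace]
    simp only [smul_eq_mul, MvPolynomial.smul_eq_C_mul, map_ofNat]
    norm_num
    ring
  -- The term with `p_0 = dA` joins the `dB` term, which makes the equations symmetric in the two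
  -- dimensions.
  have e2 : (∑ j ∈ Finset.range 1, powerTrace ι κ (1 - 1 - j) * powerTrace ι κ (j + 1) +
        Fintype.card κ • powerTrace ι κ 1) * F =
      ((Fintype.card ι : ℂ) + Fintype.card κ) • (powerTrace ι κ 1 * F) := by
    simp only [Finset.sum_range_one, MvPolynomial.smul_eq_C_mul, map_add, map_natCast,
      nsmul_eq_mul, Nat.sub_self, powerTrace_zero]
    ring
  rw [e1, e2, map_add, map_smul, map_smul, haarExpect_powerTrace_one_mul v hv] at h
  simp only [smul_eq_mul] at h
  linear_combination h

theorem haarExpect_powerTrace_three_mul (hv : ∑ x, v x * star (v x) = 1)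
    (F : MvPolynomial ((ι × κ) ⊕ (ι × κ)) ℂ) :
    ((Fintype.card ι : ℂ) * Fintype.card κ + 2) * haarExpect v (powerTrace ι κ 3 * F) +
        haarExpect v (powerTrace ι κ 3 * conjEuler (ι × κ) F) =
      ((Fintype.card ι : ℂ) + Fintype.card κ) * haarExpect v (powerTrace ι κ 2 * F) +
        haarExpect v F + haarExpect v (loopDerivation ι κ 2 F) := by
  have h := haarExpect_loop ι κ v hv 2 F
  have e1 : conjEuler (ι × κ) (powerTrace ι κ (2 + 1) * F) =
      powerTrace ι κ 3 * conjEuler (ι × κ) F + (3 : ℂ) • (powerTrace ι κ 3 * F) := by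
    rw [Derivation.leibniz, conjEuler_powerTrace]
    simp only [smul_eq_mul, MvPolynomial.smul_eq_C_mul, map_ofNat]
    norm_num
    ring
  have e2 : (∑ j ∈ Finset.range 2, powerTrace ι κ (2 - 1 - j) * powerTrace ι κ (j + 1) +
        Fintype.card κ • powerTrace ι κ 2) * F =
      ((Fintype.card ι : ℂ) + Fintype.card κ) • (powerTrace ι κ 2 * F) +
        powerTrace ι κ 1 * (powerTrace ι κ 1 * F) := by
    simp only [Finset.sum_range_succ, Finset.sum_range_zero,
      MvPolynomial.smul_eq_C_mul, map_add, map_natCast, nsmul_eq_mul]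
    norm_num
    rw [powerTrace_zero]
    ring
  rw [e1, e2, map_add, map_add, map_smul, map_smul, haarExpect_powerTrace_one_mul v hv,
    haarExpect_powerTrace_one_mul v hv] at h
  simp only [smul_eq_mul] at h
  linear_combination h

theorem haarExpect_powerTrace_four (hv : ∑ x, v x * star (v x) = 1) :
    ((Fintype.card ι : ℂ) * Fintype.card κ + 3) * haarExpect v (powerTrace ι κ 4) =
      ((Fintype.card ι : ℂ) + Fintype.card κ) * haarExpect v (powerTrace ι κ 3) +
        2 * haarExpect v (powerTrace ι κ 2) := by
  have h := haarExpect_loop ι κ v hv 3 1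
  have e1 : conjEuler (ι × κ) (powerTrace ι κ (3 + 1) * 1) = (4 : ℂ) • powerTrace ι κ 4 := by
    rw [mul_one, conjEuler_powerTrace]
    simp only [MvPolynomial.smul_eq_C_mul, map_ofNat]
    norm_num
  have e2 : (∑ j ∈ Finset.range 3, powerTrace ι κ (3 - 1 - j) * powerTrace ι κ (j + 1) +
        Fintype.card κ • powerTrace ι κ 3) * 1 =
      ((Fintype.card ι : ℂ) + Fintype.card κ) • powerTrace ι κ 3 +
        (2 : ℂ) • (powerTrace ι κ 1 * powerTrace ι κ 2) := by
    simp only [Finset.sum_range_succ, Finset.sum_range_zero,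
      MvPolynomial.smul_eq_C_mul, map_add, map_natCast, nsmul_eq_mul, map_ofNat]
    norm_num
    rw [powerTrace_zero]
    ring
  rw [e1, e2, map_add, map_smul, map_smul, map_smul, haarExpect_powerTrace_one_mul v hv, mul_one,
    Derivation.map_one_eq_zero, map_zero] at h
  simp only [smul_eq_mul] at h
  linear_combination h

theorem haarExpect_powerTrace_five (hv : ∑ x, v x * star (v x) = 1) :
    ((Fintype.card ι : ℂ) * Fintype.card κ + 4) * haarExpect v (powerTrace ι κ 5) =
      ((Fintype.card ι : ℂ) + Fintype.card κ) * haarExpect v (powerTrace ι κ 4) +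
        2 * haarExpect v (powerTrace ι κ 3) + haarExpect v (powerTrace ι κ 2 ^ 2) := by
  have h := haarExpect_loop ι κ v hv 4 1
  have e1 : conjEuler (ι × κ) (powerTrace ι κ (4 + 1) * 1) = (5 : ℂ) • powerTrace ι κ 5 := by
    rw [mul_one, conjEuler_powerTrace]
    simp only [MvPolynomial.smul_eq_C_mul, map_ofNat]
    norm_num
  have e2 : (∑ j ∈ Finset.range 4, powerTrace ι κ (4 - 1 - j) * powerTrace ι κ (j + 1) +
        Fintype.card κ • powerTrace ι κ 4) * 1 =
      ((Fintype.card ι : ℂ) + Fintype.card κ) • powerTrace ι κ 4 +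
        (2 : ℂ) • (powerTrace ι κ 1 * powerTrace ι κ 3) + powerTrace ι κ 2 ^ 2 := by
    simp only [Finset.sum_range_succ, Finset.sum_range_zero,
      MvPolynomial.smul_eq_C_mul, map_add, map_natCast, nsmul_eq_mul, map_ofNat]
    norm_num
    rw [powerTrace_zero]
    ring
  rw [e1, e2, map_add, map_add, map_smul, map_smul, map_smul, haarExpect_powerTrace_one_mul v hv,
    mul_one, Derivation.map_one_eq_zero, map_zero] at h
  simp only [smul_eq_mul] at h
  linear_combination h

/-- The recursion for powers of the purity. -/
theorem haarExpect_powerTrace_two_pow (hv : ∑ x, v x * star (v x) = 1)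
    (k : ℕ) :
    ((Fintype.card ι : ℂ) * Fintype.card κ + 2 * k + 1) *
        haarExpect v (powerTrace ι κ 2 ^ (k + 1)) =
      ((Fintype.card ι : ℂ) + Fintype.card κ) * haarExpect v (powerTrace ι κ 2 ^ k) +
        2 * k * haarExpect v (powerTrace ι κ 2 ^ (k - 1) * powerTrace ι κ 3) := by
  have h := haarExpect_powerTrace_two_mul v hv (powerTrace ι κ 2 ^ k)
  have e1 : powerTrace ι κ 2 * conjEuler (ι × κ) (powerTrace ι κ 2 ^ k) =
      (2 * k : ℂ) • powerTrace ι κ 2 ^ (k + 1) := by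
    rw [Derivation.leibniz_pow, conjEuler_powerTrace]
    cases k with
    | zero => simp
    | succ k =>
      simp only [smul_eq_mul, MvPolynomial.smul_eq_C_mul, map_ofNat, map_mul, map_natCast,
        nsmul_eq_mul, Nat.add_sub_cancel]
      push_cast
      ring
  -- For `k = 0` the truncated exponent `k - 1` is harmless, since its coefficient `2 k` vanishes.
  have e2 : loopDerivation ι κ 1 (powerTrace ι κ 2 ^ k) =
      (2 * k : ℂ) • (powerTrace ι κ 2 ^ (k - 1) * powerTrace ι κ 3) := by
    rw [Derivation.leibniz_pow, loopDerivation_powerTrace]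
    simp only [smul_eq_mul, MvPolynomial.smul_eq_C_mul, map_ofNat, map_mul, map_natCast,
      nsmul_eq_mul]
    push_cast
    ring
  rw [e1, e2, map_smul, map_smul, ← pow_succ'] at h
  simp only [smul_eq_mul] at h
  linear_combination h

theorem haarExpect_powerTrace_two_mul_powerTrace (hv : ∑ x, v x * star (v x) = 1)
    (k : ℕ) :
    ((Fintype.card ι : ℂ) * Fintype.card κ + k + 2) *
        haarExpect v (powerTrace ι κ 2 * powerTrace ι κ (k + 1)) =
      ((Fintype.card ι : ℂ) + Fintype.card κ) * haarExpect v (powerTrace ι κ (k + 1)) +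
        (k + 1) * haarExpect v (powerTrace ι κ (k + 2)) := by
  have h := haarExpect_powerTrace_two_mul v hv (powerTrace ι κ (k + 1))
  have e1 : powerTrace ι κ 2 * conjEuler (ι × κ) (powerTrace ι κ (k + 1)) =
      (k + 1 : ℂ) • (powerTrace ι κ 2 * powerTrace ι κ (k + 1)) := by
    rw [conjEuler_powerTrace]
    simp only [MvPolynomial.smul_eq_C_mul, map_add, map_natCast, map_one, nsmul_eq_mul]
    push_cast
    ring
  have e2 : loopDerivation ι κ 1 (powerTrace ι κ (k + 1)) =
      (k + 1 : ℂ) • powerTrace ι κ (k + 2) := by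
    rw [loopDerivation_powerTrace]
    simp only [MvPolynomial.smul_eq_C_mul, map_add, map_natCast, map_one, nsmul_eq_mul]
    push_cast
    ring
  rw [e1, e2, map_smul, map_smul] at h
  simp only [smul_eq_mul] at h
  linear_combination h

theorem haarExpect_powerTrace_three_sq (hv : ∑ x, v x * star (v x) = 1) :
    ((Fintype.card ι : ℂ) * Fintype.card κ + 5) * haarExpect v (powerTrace ι κ 3 ^ 2) =
      ((Fintype.card ι : ℂ) + Fintype.card κ) *
          haarExpect v (powerTrace ι κ 2 * powerTrace ι κ 3) +
        haarExpect v (powerTrace ι κ 3) + 3 * haarExpect v (powerTrace ι κ 5) := by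
  have h := haarExpect_powerTrace_three_mul v hv (powerTrace ι κ 3)
  have e1 : powerTrace ι κ 3 * conjEuler (ι × κ) (powerTrace ι κ 3) =
      (3 : ℂ) • powerTrace ι κ 3 ^ 2 := by
    rw [conjEuler_powerTrace]
    simp only [MvPolynomial.smul_eq_C_mul, map_ofNat, nsmul_eq_mul]
    push_cast
    ring
  have e2 : loopDerivation ι κ 2 (powerTrace ι κ 3) = (3 : ℂ) • powerTrace ι κ 5 := by
    rw [loopDerivation_powerTrace]
    simp only [MvPolynomial.smul_eq_C_mul, map_ofNat, nsmul_eq_mul]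
    push_cast
    ring
  rw [e1, e2, map_smul, map_smul, ← sq] at h
  simp only [smul_eq_mul] at h
  linear_combination h

theorem haarExpect_powerTrace_two_sq_mul_three (hv : ∑ x, v x * star (v x) = 1) :
    ((Fintype.card ι : ℂ) * Fintype.card κ + 6) *
        haarExpect v (powerTrace ι κ 2 ^ 2 * powerTrace ι κ 3) =
      ((Fintype.card ι : ℂ) + Fintype.card κ) *
          haarExpect v (powerTrace ι κ 2 * powerTrace ι κ 3) +
        3 * haarExpect v (powerTrace ι κ 2 * powerTrace ι κ 4) +
        2 * haarExpect v (powerTrace ι κ 3 ^ 2) := by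
  have h := haarExpect_powerTrace_two_mul v hv (powerTrace ι κ 2 * powerTrace ι κ 3)
  have e1 : powerTrace ι κ 2 * conjEuler (ι × κ) (powerTrace ι κ 2 * powerTrace ι κ 3) =
      (5 : ℂ) • (powerTrace ι κ 2 ^ 2 * powerTrace ι κ 3) := by
    rw [Derivation.leibniz, conjEuler_powerTrace, conjEuler_powerTrace]
    simp only [MvPolynomial.smul_eq_C_mul, map_ofNat, nsmul_eq_mul, smul_eq_mul]
    push_cast
    ring
  have e2 : loopDerivation ι κ 1 (powerTrace ι κ 2 * powerTrace ι κ 3) =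
      (3 : ℂ) • (powerTrace ι κ 2 * powerTrace ι κ 4) + (2 : ℂ) • powerTrace ι κ 3 ^ 2 := by
    rw [Derivation.leibniz, loopDerivation_powerTrace, loopDerivation_powerTrace]
    simp only [MvPolynomial.smul_eq_C_mul, map_ofNat, nsmul_eq_mul, smul_eq_mul]
    push_cast
    ring
  rw [e1, e2, map_smul, map_add, map_smul, map_smul, ← mul_assoc, ← sq] at h
  simp only [smul_eq_mul] at h
  linear_combination h

end Moments

/-! ### From polynomials to the random variables; exact mean and variance. -/

theorem map_eval_reducedMatrix {dA dB : ℕ} (ψ : BipartiteSpace dA dB) :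
    (reducedMatrix (Fin dA) (Fin dB)).map (MvPolynomial.eval (conjCoords ψ.ofLp)) =
      partialTraceB (pureDensity ψ) := by
  ext i j
  simp [reducedMatrix, coordMatrix, conjCoordMatrix, Matrix.mul_apply, conjCoords, partialTraceB,
    pureDensity, Matrix.vecMulVec_apply]

theorem eval_powerTrace {dA dB : ℕ} (ψ : BipartiteSpace dA dB) (k : ℕ) :
    MvPolynomial.eval (conjCoords ψ.ofLp) (powerTrace (Fin dA) (Fin dB) k) =
      (partialTraceB (pureDensity ψ) ^ k).trace := by
  rw [powerTrace, ← map_eval_reducedMatrix, ← RingHom.mapMatrix_apply, ← map_pow,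
    RingHom.mapMatrix_apply, AddMonoidHom.map_trace (MvPolynomial.eval (conjCoords ψ.ofLp))]

theorem isHermitian_partialTraceB_pureDensity {dA dB : ℕ} (ψ : BipartiteSpace dA dB) :
    (partialTraceB (pureDensity ψ)).IsHermitian := by
  ext i j
  simp [partialTraceB, pureDensity, Matrix.vecMulVec_apply, mul_comm]

theorem ofReal_re_trace_pow {dA dB : ℕ} (ψ : BipartiteSpace dA dB) (k : ℕ) :
    (((partialTraceB (pureDensity ψ) ^ k).trace.re : ℝ) : ℂ) =
      (partialTraceB (pureDensity ψ) ^ k).trace := by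
  refine Complex.conj_eq_iff_re.1 ?_
  have h := (isHermitian_partialTraceB_pureDensity ψ).pow k
  rw [starRingEnd_apply, ← Matrix.trace_conjTranspose, h.eq]

theorem ofReal_spreadRV {dA dB : ℕ} (ψ₀ : BipartiteSpace dA dB)
    (U : Matrix.unitaryGroup (Fin dA × Fin dB) ℂ) :
    ((spreadRV ψ₀ U : ℝ) : ℂ) = MvPolynomial.eval (conjCoords (U.1.mulVec ψ₀.ofLp))
      (powerTrace (Fin dA) (Fin dB) 3 - powerTrace (Fin dA) (Fin dB) 2 ^ 2) := by
  have h := fun k => eval_powerTrace (unitaryAct U ψ₀) k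
  simp only [unitaryAct] at h
  rw [map_sub, map_pow, h, h, spreadRV, linearRenyiSpread]
  push_cast
  rw [ofReal_re_trace_pow, ofReal_re_trace_pow]
  rfl

theorem sum_mul_star_eq_one {dA dB : ℕ} (ψ₀ : BipartiteSpace dA dB) (h : ‖ψ₀‖ = 1) :
    ∑ x, ψ₀.ofLp x * star (ψ₀.ofLp x) = 1 := by
  have h2 : ∑ x, ‖ψ₀ x‖ ^ 2 = 1 := by rw [← EuclideanSpace.norm_sq_eq, h, one_pow]
  have h3 := congrArg (fun r : ℝ => (r : ℂ)) h2
  push_cast at h3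
  rw [← h3]
  exact Finset.sum_congr rfl fun x _ => Complex.mul_conj' _

theorem continuous_spreadRV {dA dB : ℕ} (ψ₀ : BipartiteSpace dA dB) :
    Continuous (spreadRV ψ₀) := by
  have h := Complex.continuous_re.comp (continuous_eval_conjCoords_mulVec ψ₀.ofLp
    (powerTrace (Fin dA) (Fin dB) 3 - powerTrace (Fin dA) (Fin dB) 2 ^ 2))
  refine h.congr fun U => ?_
  rw [Function.comp_apply, ← ofReal_spreadRV, Complex.ofReal_re]

theorem memLp_spreadRV {dA dB : ℕ} (ψ₀ : BipartiteSpace dA dB) :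
    MemLp (spreadRV ψ₀) 2 (haarUnitary (Fin dA × Fin dB)) := by
  obtain ⟨C, hC⟩ := isCompact_univ.exists_bound_of_continuousOn (continuous_spreadRV ψ₀).continuousOn
  exact MemLp.of_bound (continuous_spreadRV ψ₀).aestronglyMeasurable C
    (.of_forall fun U => hC U trivial)

theorem ofReal_integral_spreadRV_pow {dA dB : ℕ} (ψ₀ : BipartiteSpace dA dB) (k : ℕ) :
    ((∫ U, spreadRV ψ₀ U ^ k ∂haarUnitary (Fin dA × Fin dB) : ℝ) : ℂ) =
      haarExpect ψ₀.ofLp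
        ((powerTrace (Fin dA) (Fin dB) 3 - powerTrace (Fin dA) (Fin dB) 2 ^ 2) ^ k) := by
  rw [← integral_complex_ofReal]
  refine integral_congr_ae (.of_forall fun U => ?_)
  simp only [Complex.ofReal_pow, ofReal_spreadRV, map_pow]

/-- The linear system satisfied by the moments determines the variance. -/
theorem variance_of_moment_system {K : Type*} [Field K]
    {s d M2 M3 M4 M5 M22 M23 M24 M33 M222 M223 M2222 : K}
    (e2 : (d + 1) * M2 = s)
    (e3 : (d + 2) * M3 = s * M2 + 1)
    (e22 : (d + 3) * M22 = s * M2 + 2 * M3)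
    (e4 : (d + 3) * M4 = s * M3 + 2 * M2)
    (e23 : (d + 4) * M23 = s * M3 + 3 * M4)
    (e5 : (d + 4) * M5 = s * M4 + 2 * M3 + M22)
    (e222 : (d + 5) * M222 = s * M22 + 4 * M23)
    (e33 : (d + 5) * M33 = s * M23 + M3 + 3 * M5)
    (e24 : (d + 5) * M24 = s * M4 + 4 * M5)
    (e223 : (d + 6) * M223 = s * M23 + 3 * M24 + 2 * M33)
    (e2222 : (d + 7) * M2222 = s * M222 + 6 * M223) :
    (d + 1) ^ 2 * (d + 2) ^ 2 * (d + 3) ^ 2 * (d + 4) * (d + 5) * (d + 6) * (d + 7) *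
        (M33 - 2 * M223 + M2222 - (M3 - M22) ^ 2) =
      ((d + 1) ^ 2 - s ^ 2) *
        ((2 * d ^ 4 - 14 * d ^ 3 - 62 * d ^ 2 + 182 * d + 588) * s ^ 2 +
          (3 * d ^ 5 + 23 * d ^ 4 + 47 * d ^ 3 + 49 * d ^ 2 + 190 * d + 168)) := by
  -- The digits of a moment list its factors: `M223` stands for `p_2² p_3`. The triangular system is
  -- solved with denominators cleared, so no `d + k` need be nonzero.
  have h2 : (d + 1) * M2 = s := by
    linear_combination e2
  have h3 : (d + 1) * (d + 2) * M3 = s ^ 2 + d + 1 := by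
    linear_combination (d + 1) * e3 + s * h2
  have h22 : (d + 1) * (d + 2) * (d + 3) * M22 = s ^ 2 * d + 4 * s ^ 2 + 2 * d + 2 := by
    linear_combination (d + 1) * (d + 2) * e22 + s * (d + 2) * h2 + 2 * h3
  have h4 : (d + 1) * (d + 2) * (d + 3) * M4 = s ^ 3 + 3 * s * d + 5 * s := by
    linear_combination (d + 1) * (d + 2) * e4 + s * h3 + 2 * (d + 2) * h2
  have h23 : (d + 1) * (d + 2) * (d + 3) * (d + 4) * M23 = s ^ 3 * d + 6 * s ^ 3 + s * d ^ 2
      + 13 * s * d + 18 * s := by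
    linear_combination (d + 1) * (d + 2) * (d + 3) * e23 + s * (d + 3) * h3 + 3 * h4
  have h5 : (d + 1) * (d + 2) * (d + 3) * (d + 4) * M5 = s ^ 4 + 6 * s ^ 2 * d + 15 * s ^ 2 + 2 *
      d ^ 2 + 10 * d + 8 := by
    linear_combination (d + 1) * (d + 2) * (d + 3) * e5 + s * h4 + 2 * (d + 3) * h3 + h22
  have h222 : (d + 1) * (d + 2) * (d + 3) * (d + 4) * (d + 5) * M222 = s ^ 3 * d ^ 2 + 12 *
      s ^ 3 * d + 40 * s ^ 3 + 6 * s * d ^ 2 + 62 * s * d + 80 * s := by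
    linear_combination (d + 1) * (d + 2) * (d + 3) * (d + 4) * e222 + s * (d + 4) * h22 + 4 * h23
  have h33 : (d + 1) * (d + 2) * (d + 3) * (d + 4) * (d + 5) * M33 = s ^ 4 * d + 9 * s ^ 4 + 2 *
      s ^ 2 * d ^ 2 + 38 * s ^ 2 * d + 75 * s ^ 2 + d ^ 3 + 14 * d ^ 2 + 49 * d + 36 := by
    linear_combination (d + 1) * (d + 2) * (d + 3) * (d + 4) * e33 + s * h23 + (d + 3) * (d + 4) *
        h3 + 3 * h5
  have h24 : (d + 1) * (d + 2) * (d + 3) * (d + 4) * (d + 5) * M24 = s ^ 4 * d + 8 * s ^ 4 + 3 *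
      s ^ 2 * d ^ 2 + 41 * s ^ 2 * d + 80 * s ^ 2 + 8 * d ^ 2 + 40 * d + 32 := by
    linear_combination (d + 1) * (d + 2) * (d + 3) * (d + 4) * e24 + s * (d + 4) * h4 + 4 * h5
  have h223 : (d + 1) * (d + 2) * (d + 3) * (d + 4) * (d + 5) * (d + 6) * M223 = s ^ 4 * d ^ 2
      + 16 * s ^ 4 * d + 72 * s ^ 4 + s ^ 2 * d ^ 3 + 31 * s ^ 2 * d ^ 2 + 282 * s ^ 2 * d + 480 *
      s ^ 2 + 2 * d ^ 3 + 52 * d ^ 2 + 218 * d + 168 := by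
    linear_combination (d + 1) * (d + 2) * (d + 3) * (d + 4) * (d + 5) * e223 + s * (d + 5) * h23
        + 3 * h24 + 2 * h33
  have h2222 : (d + 1) * (d + 2) * (d + 3) * (d + 4) * (d + 5) * (d + 6) * (d + 7) * M2222 =
      s ^ 4 * d ^ 3 + 24 * s ^ 4 * d ^ 2 + 208 * s ^ 4 * d + 672 * s ^ 4 + 12 * s ^ 2 * d ^ 3
      + 284 * s ^ 2 * d ^ 2 + 2144 * s ^ 2 * d + 3360 * s ^ 2 + 12 * d ^ 3 + 312 * d ^ 2 + 1308 *
      d + 1008 := by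
    linear_combination (d + 1) * (d + 2) * (d + 3) * (d + 4) * (d + 5) * (d + 6) * e2222 + s * (d
        + 6) * h222 + 6 * h223
  have hm : (d + 1) * (d + 2) * (d + 3) * (M3 - M22) = (d + 1) ^ 2 - s ^ 2 := by
    linear_combination (d + 3) * h3 - h22
  -- The squared mean enters through `hm` multiplied by the sum of its two sides, a difference of
  -- squares.
  linear_combination (d + 1) * (d + 2) * (d + 3) * ((d + 6) * (d + 7) * h33 - 2 * (d + 7) * h223
      + h2222) - (d + 4) * (d + 5) * (d + 6) * (d + 7) * ((d + 1) * (d + 2) * (d + 3) * (M3 - M22)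
      + ((d + 1) ^ 2 - s ^ 2)) * hm

theorem spreadMean_eq {dA dB : ℕ} (ψ₀ : BipartiteSpace dA dB) (h : ‖ψ₀‖ = 1) :
    spreadMean ψ₀ = ((dA : ℝ) ^ 2 - 1) * ((dB : ℝ) ^ 2 - 1) /
      (((dA : ℝ) * dB + 1) * ((dA : ℝ) * dB + 2) * ((dA : ℝ) * dB + 3)) := by
  have hv := sum_mul_star_eq_one ψ₀ h
  have h0 := ofReal_integral_spreadRV_pow ψ₀ 1
  simp only [pow_one, map_sub] at h0
  have m2 := haarExpect_powerTrace_two_pow ψ₀.ofLp hv 0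
  have m22 := haarExpect_powerTrace_two_pow ψ₀.ofLp hv 1
  have m3 := haarExpect_powerTrace_three_mul ψ₀.ofLp hv 1
  have n : ∀ k : ℕ, (dA : ℂ) * dB + ((k + 1 : ℕ) : ℂ) ≠ 0 := fun k => by
    exact_mod_cast Nat.succ_ne_zero (dA * dB + k)
  have n1 := n 0
  have n2 := n 1
  have n3 := n 2
  simp only [Fintype.card_fin, zero_add, pow_one, pow_zero, one_mul, mul_one, Nat.cast_zero,
    mul_zero, zero_mul, add_zero, haarExpect_one, Nat.cast_one, Nat.sub_self, Nat.reduceAdd,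
    Derivation.map_one_eq_zero, map_zero] at m2 m22 m3 n1 n2 n3
  push_cast at n2 n3
  generalize haarExpect ψ₀.ofLp (powerTrace (Fin dA) (Fin dB) 2) = M2 at *
  generalize haarExpect ψ₀.ofLp (powerTrace (Fin dA) (Fin dB) 3) = M3 at *
  generalize haarExpect ψ₀.ofLp (powerTrace (Fin dA) (Fin dB) 2 ^ 2) = M22 at *
  rw [spreadMean]
  rw [← Complex.ofReal_inj, h0]
  push_cast
  rw [eq_div_iff (by simp [n1, n2, n3])]
  linear_combination ((dA : ℂ) * dB + 1) ^ 2 * m3 -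
    ((dA : ℂ) * dB + 1) * ((dA : ℂ) * dB + 2) * m22 - ((dA : ℂ) + dB) * m2

theorem spreadVariance_eq {dA dB : ℕ} (ψ₀ : BipartiteSpace dA dB) (h : ‖ψ₀‖ = 1) :
    spreadVariance ψ₀ = ((dA : ℝ) ^ 2 - 1) * ((dB : ℝ) ^ 2 - 1) * variancePoly dA dB /
      (((dA : ℝ) * dB + 1) ^ 2 * ((dA : ℝ) * dB + 2) ^ 2 * ((dA : ℝ) * dB + 3) ^ 2 *
        ((dA : ℝ) * dB + 4) * ((dA : ℝ) * dB + 5) * ((dA : ℝ) * dB + 6) *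
        ((dA : ℝ) * dB + 7)) := by
  have hv := sum_mul_star_eq_one ψ₀ h
  have h1 := ofReal_integral_spreadRV_pow ψ₀ 1
  have h2 := ofReal_integral_spreadRV_pow ψ₀ 2
  rw [show (powerTrace (Fin dA) (Fin dB) 3 - powerTrace (Fin dA) (Fin dB) 2 ^ 2) ^ 2 =
    powerTrace (Fin dA) (Fin dB) 3 ^ 2 -
      (2 : ℂ) • (powerTrace (Fin dA) (Fin dB) 2 ^ 2 * powerTrace (Fin dA) (Fin dB) 3) +
      powerTrace (Fin dA) (Fin dB) 2 ^ 4 by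
    rw [MvPolynomial.smul_eq_C_mul, map_ofNat]
    ring, map_add, map_sub, map_smul, smul_eq_mul] at h2
  rw [pow_one, map_sub] at h1
  simp only [pow_one] at h1
  have key := variance_of_moment_system (s := (dA : ℂ) + dB) (d := (dA : ℂ) * dB)
    (M2 := haarExpect ψ₀.ofLp (powerTrace (Fin dA) (Fin dB) 2))
    (M3 := haarExpect ψ₀.ofLp (powerTrace (Fin dA) (Fin dB) 3))
    (M4 := haarExpect ψ₀.ofLp (powerTrace (Fin dA) (Fin dB) 4))
    (M5 := haarExpect ψ₀.ofLp (powerTrace (Fin dA) (Fin dB) 5))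
    (M22 := haarExpect ψ₀.ofLp (powerTrace (Fin dA) (Fin dB) 2 ^ 2))
    (M23 := haarExpect ψ₀.ofLp (powerTrace (Fin dA) (Fin dB) 2 * powerTrace (Fin dA) (Fin dB) 3))
    (M24 := haarExpect ψ₀.ofLp (powerTrace (Fin dA) (Fin dB) 2 * powerTrace (Fin dA) (Fin dB) 4))
    (M33 := haarExpect ψ₀.ofLp (powerTrace (Fin dA) (Fin dB) 3 ^ 2))
    (M222 := haarExpect ψ₀.ofLp (powerTrace (Fin dA) (Fin dB) 2 ^ 3))
    (M223 := haarExpect ψ₀.ofLp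
      (powerTrace (Fin dA) (Fin dB) 2 ^ 2 * powerTrace (Fin dA) (Fin dB) 3))
    (M2222 := haarExpect ψ₀.ofLp (powerTrace (Fin dA) (Fin dB) 2 ^ 4))
    (by simpa [haarExpect_one] using haarExpect_powerTrace_two_pow ψ₀.ofLp hv 0)
    (by simpa [haarExpect_one] using haarExpect_powerTrace_three_mul ψ₀.ofLp hv 1)
    (by
      have := haarExpect_powerTrace_two_pow ψ₀.ofLp hv 1
      norm_num at this
      linear_combination this)
    (by simpa using haarExpect_powerTrace_four ψ₀.ofLp hv)
    (by
      have := haarExpect_powerTrace_two_mul_powerTrace ψ₀.ofLp hv 2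
      norm_num at this
      linear_combination this)
    (by simpa using haarExpect_powerTrace_five ψ₀.ofLp hv)
    (by
      have := haarExpect_powerTrace_two_pow ψ₀.ofLp hv 2
      norm_num at this
      linear_combination this)
    (by simpa using haarExpect_powerTrace_three_sq ψ₀.ofLp hv)
    (by
      have := haarExpect_powerTrace_two_mul_powerTrace ψ₀.ofLp hv 3
      norm_num at this
      linear_combination this)
    (by simpa using haarExpect_powerTrace_two_sq_mul_three ψ₀.ofLp hv)
    (by
      have := haarExpect_powerTrace_two_pow ψ₀.ofLp hv 3
      norm_num at this
      linear_combination this)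
  rw [← h1, ← h2] at key
  rw [spreadVariance, variance_eq_sub (memLp_spreadRV ψ₀), eq_div_iff (by positivity)]
  simp only [Pi.pow_apply]
  generalize ∫ U, spreadRV ψ₀ U ^ 2 ∂haarUnitary (Fin dA × Fin dB) = I2 at *
  generalize ∫ U, spreadRV ψ₀ U ∂haarUnitary (Fin dA × Fin dB) = I1 at *
  rw [← Complex.ofReal_inj, variancePoly]
  push_cast
  linear_combination key

/-! ### Orders of magnitude of mean and variance. -/

section Asymptotics

variable {a b : ℝ}

theorem three_quarters_sq_le (ha : 2 ≤ a) : 3 / 4 * a ^ 2 ≤ a ^ 2 - 1 := by nlinarith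

theorem four_le_mul (ha : 2 ≤ a) (hb : 2 ≤ b) : 4 ≤ a * b := by nlinarith

theorem sq_sub_one_mul_lower (ha : 2 ≤ a) (hb : 2 ≤ b) :
    9 / 16 * (a * b) ^ 2 ≤ (a ^ 2 - 1) * (b ^ 2 - 1) := by
  have := mul_le_mul (three_quarters_sq_le ha) (three_quarters_sq_le hb) (by positivity)
    (by nlinarith)
  linarith

theorem sq_sub_one_mul_upper (ha : 2 ≤ a) (b : ℝ) :
    (a ^ 2 - 1) * (b ^ 2 - 1) ≤ (a * b) ^ 2 := by
  nlinarith [sq_nonneg a, sq_nonneg b]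

theorem mean_bounds (ha : 2 ≤ a) (hb : 2 ≤ b) :
    1 / 10 / (a * b) ≤
        (a ^ 2 - 1) * (b ^ 2 - 1) / ((a * b + 1) * (a * b + 2) * (a * b + 3)) ∧
      (a ^ 2 - 1) * (b ^ 2 - 1) / ((a * b + 1) * (a * b + 2) * (a * b + 3)) ≤ 1 / (a * b) := by
  have h4 := four_le_mul ha hb
  have hl := sq_sub_one_mul_lower ha hb
  have hu := sq_sub_one_mul_upper ha b
  set d := a * b
  set N := (a ^ 2 - 1) * (b ^ 2 - 1)
  have hd : 0 < d := by linarith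
  constructor
  · rw [div_le_div_iff₀ hd (by positivity)]
    -- For `d ≥ 4` the denominator is at most `28/5 d³`, and `(9/16) / (28/5) = 45/448` just exceeds
    -- `1/10`.
    have h1 : (d + 1) * (d + 2) * (d + 3) ≤ (2 * d) * (2 * d) * d * (7 / 5) := by
      nlinarith [mul_pos hd hd, mul_pos hd (mul_pos hd hd)]
    nlinarith [mul_pos hd hd, mul_pos hd (mul_pos hd hd)]
  · rw [div_le_div_iff₀ (by positivity) hd]
    have h1 : N * d ≤ d ^ 2 * d := by gcongr
    nlinarith [mul_pos hd hd]

theorem variancePoly_eq (a b : ℝ) : variancePoly a b =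
    (2 * (a * b) ^ 4 - 14 * (a * b) ^ 3 - 62 * (a * b) ^ 2 + 182 * (a * b) + 588) * (a + b) ^ 2 +
      (3 * (a * b) ^ 5 + 23 * (a * b) ^ 4 + 47 * (a * b) ^ 3 + 49 * (a * b) ^ 2 +
        190 * (a * b) + 168) := by
  rw [variancePoly]
  ring

theorem variancePoly_lower (ha : 2 ≤ a) (hb : 2 ≤ b) : (a * b) ^ 5 ≤ variancePoly a b := by
  have h4 := four_le_mul ha hb
  have hs : (a + b) ^ 2 ≤ (a * b / 2 + 2) ^ 2 := by
    -- This is `(a - 2)(b - 2) ≥ 0`. It is needed because the coefficient of `(a + b)²` is negative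
    -- for some small `d`, for instance `-60` at `d = 4`.
    have : a + b ≤ a * b / 2 + 2 := by nlinarith
    exact pow_le_pow_left₀ (by linarith) this 2
  rw [variancePoly_eq]
  have hs0 := sq_nonneg (a + b)
  generalize a * b = d at *
  generalize (a + b) ^ 2 = t at *
  obtain ⟨x, rfl⟩ : ∃ x, d = x + 4 := ⟨d - 4, by ring⟩
  have hx : 0 ≤ x := by linarith
  rcases le_total 0 (2 * (x + 4) ^ 4 - 14 * (x + 4) ^ 3 - 62 * (x + 4) ^ 2 + 182 * (x + 4) + 588)
    with hq | hq
  · have h1 := mul_nonneg hq hs0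
    have h2 : (x + 4) ^ 5 ≤ 3 * (x + 4) ^ 5 + 23 * (x + 4) ^ 4 + 47 * (x + 4) ^ 3 +
        49 * (x + 4) ^ 2 + 190 * (x + 4) + 168 := by
      have : 0 ≤ 2 * (x + 4) ^ 5 + 23 * (x + 4) ^ 4 + 47 * (x + 4) ^ 3 +
        49 * (x + 4) ^ 2 + 190 * (x + 4) + 168 := by positivity
      linarith
    linarith
  · have h1 := mul_le_mul_of_nonpos_left hs hq
    -- The target difference at the extreme value `t = (d/2 + 2)²`, expanded around `d = 4`; all its
    -- coefficients are positive.
    have h2 : 0 ≤ 11696 + 3462 * x + 1582 * x ^ 2 + 752.5 * x ^ 3 + 157.5 * x ^ 4 +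
      14.5 * x ^ 5 + 0.5 * x ^ 6 := by positivity
    linarith

theorem variancePoly_upper (ha : 2 ≤ a) (hb : 2 ≤ b) {κ : ℝ} (hκ : 1 ≤ κ) (h1 : a ≤ κ * b)
    (h2 : b ≤ κ * a) : variancePoly a b ≤ 46 * κ * (a * b) ^ 5 := by
  have h4 := four_le_mul ha hb
  have hs : (a + b) ^ 2 ≤ 4 * κ * (a * b) := by nlinarith
  rw [variancePoly_eq]
  have hs0 := sq_nonneg (a + b)
  generalize a * b = d at *
  generalize (a + b) ^ 2 = t at *
  have hd : 0 ≤ d := by linarith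
  have p2 : 4 * d ≤ d ^ 2 := by nlinarith
  have p3 : 4 * d ^ 2 ≤ d ^ 3 := by nlinarith [mul_le_mul_of_nonneg_right h4 (sq_nonneg d)]
  have p4 : 4 * d ^ 3 ≤ d ^ 4 := by
    nlinarith [mul_le_mul_of_nonneg_right h4 (pow_nonneg hd 3)]
  have p5 : 4 * d ^ 4 ≤ d ^ 5 := by
    nlinarith [mul_le_mul_of_nonneg_right h4 (pow_nonneg hd 4)]
  -- The constant `46` is `8 · 4 + 14`, from `q1` with `(a + b)² ≤ 4 κ d`, and from `q2`.
  have q1 : 2 * d ^ 4 - 14 * d ^ 3 - 62 * d ^ 2 + 182 * d + 588 ≤ 8 * d ^ 4 := by linarith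
  have q2 : 3 * d ^ 5 + 23 * d ^ 4 + 47 * d ^ 3 + 49 * d ^ 2 + 190 * d + 168 ≤ 14 * d ^ 5 := by
    linarith
  have q3 := mul_le_mul_of_nonneg_right q1 hs0
  have q4 : 8 * d ^ 4 * t ≤ 8 * d ^ 4 * (4 * κ * d) := by gcongr
  have q5 : 14 * d ^ 5 ≤ 14 * d ^ 5 * κ := le_mul_of_one_le_right (by positivity) hκ
  linarith

theorem variance_bounds (ha : 2 ≤ a) (hb : 2 ≤ b) :
    1 / 200000 / (a * b) ^ 3 ≤ (a ^ 2 - 1) * (b ^ 2 - 1) * variancePoly a b /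
      ((a * b + 1) ^ 2 * (a * b + 2) ^ 2 * (a * b + 3) ^ 2 * (a * b + 4) * (a * b + 5) *
        (a * b + 6) * (a * b + 7)) ∧
    ∀ κ : ℝ, 1 ≤ κ → a ≤ κ * b → b ≤ κ * a →
      (a ^ 2 - 1) * (b ^ 2 - 1) * variancePoly a b /
      ((a * b + 1) ^ 2 * (a * b + 2) ^ 2 * (a * b + 3) ^ 2 * (a * b + 4) * (a * b + 5) *
        (a * b + 6) * (a * b + 7)) ≤ 46 * κ / (a * b) ^ 3 := by
  have h4 := four_le_mul ha hb
  have hl := sq_sub_one_mul_lower ha hb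
  have hu := sq_sub_one_mul_upper ha b
  have hP := variancePoly_lower ha hb
  have hd : 0 < a * b := by linarith
  constructor
  · rw [div_le_div_iff₀ (by positivity) (by positivity)]
    -- Each of the ten factors is at most `3 d` as `d ≥ 4`, and `3^10 / 200000 < 9/16`.
    calc 1 / 200000 * ((a * b + 1) ^ 2 * (a * b + 2) ^ 2 * (a * b + 3) ^ 2 * (a * b + 4) *
          (a * b + 5) * (a * b + 6) * (a * b + 7))
        ≤ 1 / 200000 * ((3 * (a * b)) ^ 2 * (3 * (a * b)) ^ 2 * (3 * (a * b)) ^ 2 *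
          (3 * (a * b)) * (3 * (a * b)) * (3 * (a * b)) * (3 * (a * b))) := by
          gcongr <;> linarith
      _ ≤ 9 / 16 * (a * b) ^ 2 * (a * b) ^ 5 * (a * b) ^ 3 := by
          have := pow_pos hd 10
          nlinarith
      _ ≤ (a ^ 2 - 1) * (b ^ 2 - 1) * variancePoly a b * (a * b) ^ 3 := by
          have : 0 ≤ (a ^ 2 - 1) * (b ^ 2 - 1) := le_trans (by positivity) hl
          gcongr
  · intro κ hκ h1 h2
    have hPu := variancePoly_upper ha hb hκ h1 h2
    have hP0 : 0 ≤ variancePoly a b := le_trans (by positivity) hP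
    rw [div_le_div_iff₀ (by positivity) (by positivity)]
    calc (a ^ 2 - 1) * (b ^ 2 - 1) * variancePoly a b * (a * b) ^ 3
        ≤ (a * b) ^ 2 * (46 * κ * (a * b) ^ 5) * (a * b) ^ 3 := by gcongr
      _ = 46 * κ * ((a * b) ^ 2 * (a * b) ^ 2 * (a * b) ^ 2 * (a * b) *
          (a * b) * (a * b) * (a * b)) := by ring
      _ ≤ _ := by gcongr <;> linarith

end Asymptotics

/-! ### Two qubits: the law of the purity. -/

/-- Probability measures on a compact interval are determined by their moments. -/
theorem ext_of_forall_integral_pow_eq {μ ν : Measure ℝ} [IsProbabilityMeasure μ]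
    [IsProbabilityMeasure ν] {a b : ℝ} (hμ : ∀ᵐ x ∂μ, x ∈ Set.Icc a b)
    (hν : ∀ᵐ x ∂ν, x ∈ Set.Icc a b) (h : ∀ k : ℕ, ∫ x, x ^ k ∂μ = ∫ x, x ^ k ∂ν) : μ = ν := by
  have hcont : ∀ {ρ : Measure ℝ} [IsProbabilityMeasure ρ], (∀ᵐ x ∂ρ, x ∈ Set.Icc a b) →
      ∀ f : ℝ → ℝ, Continuous f → Integrable f ρ := by
    intro ρ _ hρ f hf
    obtain ⟨C, hC⟩ := (isCompact_Icc (a := a) (b := b)).exists_bound_of_continuousOn hf.continuousOn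
    exact Integrable.of_bound hf.aestronglyMeasurable C (hρ.mono fun x hx => hC x hx)
  have hpoly : ∀ p : Polynomial ℝ, ∫ x, p.eval x ∂μ = ∫ x, p.eval x ∂ν := by
    intro p
    simp only [Polynomial.eval_eq_sum_range]
    rw [integral_finsetSum _ fun i _ => hcont hμ _ (by fun_prop),
      integral_finsetSum _ fun i _ => hcont hν _ (by fun_prop)]
    simp only [integral_const_mul, h]
  have happrox : ∀ {ρ : Measure ℝ} [IsProbabilityMeasure ρ], (∀ᵐ x ∂ρ, x ∈ Set.Icc a b) →
      ∀ (f : ℝ → ℝ) (p : Polynomial ℝ) (ε : ℝ), Continuous f →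
      (∀ x ∈ Set.Icc a b, |p.eval x - f x| < ε) → |∫ x, p.eval x ∂ρ - ∫ x, f x ∂ρ| ≤ ε := by
    intro ρ _ hρ f p ε hf hp
    rw [← integral_sub (hcont hρ _ p.continuous) (hcont hρ _ hf)]
    have := norm_integral_le_of_norm_le_const (μ := ρ) (f := fun x => p.eval x - f x) (C := ε)
      (hρ.mono fun x hx => (hp x hx).le)
    simpa using this
  refine ext_of_forall_integral_eq_of_IsFiniteMeasure fun f => ?_
  refine eq_of_forall_dist_le fun ε hε => ?_
  obtain ⟨p, hp⟩ := exists_polynomial_near_of_continuousOn a b f f.continuous.continuousOn (ε / 2)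
    (by positivity)
  have h1 := happrox hμ f p _ f.continuous hp
  have h2 := happrox hν f p _ f.continuous hp
  rw [hpoly p] at h1
  rw [Real.dist_eq]
  rw [abs_le] at *
  constructor <;> linarith

/-- The law of the difference of the two Schmidt weights of a random two-qubit state. -/
noncomputable def schmidtGapLaw : Measure ℝ :=
  (volume.restrict (Set.Ioo (0 : ℝ) 1)).withDensity fun u => ENNReal.ofReal (3 * u ^ 2)

theorem integral_schmidtGapLaw (f : ℝ → ℝ) :
    ∫ u, f u ∂schmidtGapLaw = ∫ u in (0 : ℝ)..1, 3 * u ^ 2 * f u := by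
  rw [schmidtGapLaw, integral_withDensity_eq_integral_toReal_smul (by fun_prop)
    (.of_forall fun _ => ENNReal.ofReal_lt_top), intervalIntegral.integral_of_le zero_le_one,
    integral_Ioc_eq_integral_Ioo]
  refine integral_congr_ae (.of_forall fun u => ?_)
  simp only [smul_eq_mul]
  rw [ENNReal.toReal_ofReal (by positivity)]

instance schmidtGapLaw_isProbabilityMeasure : IsProbabilityMeasure schmidtGapLaw := by
  constructor
  rw [schmidtGapLaw, withDensity_apply _ MeasurableSet.univ, Measure.restrict_univ,
    ← ofReal_integral_eq_lintegral_ofReal, ← integral_Ioc_eq_integral_Ioo,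
    ← intervalIntegral.integral_of_le zero_le_one]
  · norm_num
  · exact ((by fun_prop : Continuous fun u : ℝ => 3 * u ^ 2).continuousOn.integrableOn_Icc
      (a := 0) (b := 1)).mono_set Set.Ioo_subset_Icc_self
  · exact .of_forall fun u => by positivity

/-- The recursion for the moments of the purity. -/
theorem integral_schmidtGapLaw_recursion (k : ℕ) :
    (2 * (k : ℝ) + 5) * ∫ u, ((1 + u ^ 2) / 2) ^ (k + 1) ∂schmidtGapLaw =
      (3 * (k : ℝ) + 4) * ∫ u, ((1 + u ^ 2) / 2) ^ k ∂schmidtGapLaw -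
        (k : ℝ) * ∫ u, ((1 + u ^ 2) / 2) ^ (k - 1) ∂schmidtGapLaw := by
  simp only [integral_schmidtGapLaw]
  -- With `x = (1 + u²) / 2`, the primitive `3 u³ x^k (x - 1)` vanishes at both ends of `[0, 1]`;
  -- integrating its derivative gives the recursion.
  have hd : ∀ u ∈ Set.uIcc (0 : ℝ) 1, HasDerivAt
      (fun u : ℝ => 3 * (u ^ 3 * ((1 + u ^ 2) / 2) ^ k * ((1 + u ^ 2) / 2 - 1)))
      ((2 * k + 5) * (3 * u ^ 2 * ((1 + u ^ 2) / 2) ^ (k + 1)) -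
        (3 * k + 4) * (3 * u ^ 2 * ((1 + u ^ 2) / 2) ^ k) +
        k * (3 * u ^ 2 * ((1 + u ^ 2) / 2) ^ (k - 1))) u := by
    intro u _
    have hx : HasDerivAt (fun u : ℝ => (1 + u ^ 2) / 2) u u := by
      refine (((hasDerivAt_pow 2 u).const_add 1).div_const 2).congr_deriv ?_
      simp
    refine ((((hasDerivAt_pow 3 u).mul (hx.pow k)).mul (hx.sub_const 1)).const_mul 3).congr_deriv ?_
    cases k with
    | zero =>
      simp
      ring
    | succ k =>
      simp only [Nat.add_sub_cancel, Pi.pow_apply, Pi.mul_apply]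
      push_cast
      ring
  have hi := intervalIntegral.integral_eq_sub_of_hasDerivAt hd
    (Continuous.intervalIntegrable (by fun_prop) _ _)
  rw [intervalIntegral.integral_add, intervalIntegral.integral_sub,
    intervalIntegral.integral_const_mul, intervalIntegral.integral_const_mul,
    intervalIntegral.integral_const_mul] at hi
  · norm_num at hi
    linarith
  all_goals exact Continuous.intervalIntegrable (by fun_prop) _ _

/-- The purity of the reduced state. -/
noncomputable def purityRV {dA dB : ℕ} (ψ₀ : BipartiteSpace dA dB)
    (U : Matrix.unitaryGroup (Fin dA × Fin dB) ℂ) : ℝ :=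
  ((partialTraceB (pureDensity (unitaryAct U ψ₀)) ^ 2).trace).re

theorem ofReal_purityRV {dA dB : ℕ} (ψ₀ : BipartiteSpace dA dB)
    (U : Matrix.unitaryGroup (Fin dA × Fin dB) ℂ) :
    ((purityRV ψ₀ U : ℝ) : ℂ) = MvPolynomial.eval (conjCoords (U.1.mulVec ψ₀.ofLp))
      (powerTrace (Fin dA) (Fin dB) 2) := by
  rw [purityRV, ofReal_re_trace_pow, ← eval_powerTrace]
  rfl

theorem continuous_purityRV {dA dB : ℕ} (ψ₀ : BipartiteSpace dA dB) :
    Continuous (purityRV ψ₀) := by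
  have h := Complex.continuous_re.comp (continuous_eval_conjCoords_mulVec ψ₀.ofLp
    (powerTrace (Fin dA) (Fin dB) 2))
  refine h.congr fun U => ?_
  rw [Function.comp_apply, ← ofReal_purityRV, Complex.ofReal_re]

theorem ofReal_integral_purityRV_pow {dA dB : ℕ} (ψ₀ : BipartiteSpace dA dB) (k : ℕ) :
    ((∫ U, purityRV ψ₀ U ^ k ∂haarUnitary (Fin dA × Fin dB) : ℝ) : ℂ) =
      haarExpect ψ₀.ofLp (powerTrace (Fin dA) (Fin dB) 2 ^ k) := by
  rw [← integral_complex_ofReal]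
  refine integral_congr_ae (.of_forall fun U => ?_)
  simp only [Complex.ofReal_pow, ofReal_purityRV, map_pow]

/-- Newton's identity for two eigenvalues, where the third elementary symmetric function is zero. At
trace one it makes `p_3` affine in `p_2`. -/
theorem trace_pow_three_fin_two {R : Type*} [CommRing R] (A : Matrix (Fin 2) (Fin 2) R) :
    2 * (A ^ 3).trace = 3 * A.trace * (A ^ 2).trace - A.trace ^ 3 := by
  simp only [pow_succ, pow_zero, one_mul, Matrix.trace_fin_two, Matrix.mul_apply, Fin.sum_univ_two]
  ring

theorem eval_powerTrace_three_of_qubits (ψ₀ : BipartiteSpace 2 2) (h : ‖ψ₀‖ = 1)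
    (U : Matrix.unitaryGroup (Fin 2 × Fin 2) ℂ) :
    MvPolynomial.eval (conjCoords (U.1.mulVec ψ₀.ofLp)) (powerTrace (Fin 2) (Fin 2) 3) =
      (3 * MvPolynomial.eval (conjCoords (U.1.mulVec ψ₀.ofLp)) (powerTrace (Fin 2) (Fin 2) 2) - 1)
        / 2 := by
  have h1 := eval_powerTrace_one ψ₀.ofLp (sum_mul_star_eq_one ψ₀ h) U
  have h2 := congrArg (MvPolynomial.eval (conjCoords (U.1.mulVec ψ₀.ofLp)))
    (trace_pow_three_fin_two (reducedMatrix (Fin 2) (Fin 2)))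
  rw [powerTrace, pow_one] at h1
  simp only [map_mul, map_sub, map_pow, map_ofNat, h1] at h2
  rw [powerTrace, powerTrace]
  linear_combination h2 / 2

theorem integral_purityRV_recursion (ψ₀ : BipartiteSpace 2 2) (h : ‖ψ₀‖ = 1) (k : ℕ) :
    (2 * k + 5) * ∫ U, purityRV ψ₀ U ^ (k + 1) ∂haarUnitary (Fin 2 × Fin 2) =
      (3 * k + 4) * ∫ U, purityRV ψ₀ U ^ k ∂haarUnitary (Fin 2 × Fin 2) -
        k * ∫ U, purityRV ψ₀ U ^ (k - 1) ∂haarUnitary (Fin 2 × Fin 2) := by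
  have hr := haarExpect_powerTrace_two_pow ψ₀.ofLp (sum_mul_star_eq_one ψ₀ h) k
  have h3 : haarExpect ψ₀.ofLp
        (powerTrace (Fin 2) (Fin 2) 2 ^ (k - 1) * powerTrace (Fin 2) (Fin 2) 3) =
      haarExpect ψ₀.ofLp ((3 / 2 : ℂ) • (powerTrace (Fin 2) (Fin 2) 2 ^ (k - 1 + 1)) -
        (1 / 2 : ℂ) • powerTrace (Fin 2) (Fin 2) 2 ^ (k - 1)) := by
    refine haarExpect_congr _ fun U => ?_
    simp only [map_mul, map_sub, MvPolynomial.smul_eval, map_pow,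
      eval_powerTrace_three_of_qubits ψ₀ h]
    ring
  rw [h3, map_sub, map_smul, map_smul] at hr
  simp only [← ofReal_integral_purityRV_pow, smul_eq_mul, Fintype.card_fin] at hr
  rcases Nat.eq_zero_or_pos k with rfl | hk
  · rw [← Complex.ofReal_inj]
    push_cast at hr ⊢
    linear_combination hr
  · rw [Nat.sub_add_cancel hk] at hr
    rw [← Complex.ofReal_inj]
    push_cast at hr ⊢
    linear_combination hr

/-- Both moment sequences satisfy the same recursion with nonzero leading coefficient `2 k + 5`, and
both start at `1`. -/
theorem integral_purityRV_pow (ψ₀ : BipartiteSpace 2 2) (h : ‖ψ₀‖ = 1) (k : ℕ) :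
    ∫ U, purityRV ψ₀ U ^ k ∂haarUnitary (Fin 2 × Fin 2) =
      ∫ u, ((1 + u ^ 2) / 2) ^ k ∂schmidtGapLaw := by
  induction k using Nat.strong_induction_on with
  | _ k ih =>
    cases k with
    | zero => simp
    | succ k =>
      have h1 := integral_purityRV_recursion ψ₀ h k
      have h2 := integral_schmidtGapLaw_recursion k
      rw [ih k (by omega), ih (k - 1) (by omega), ← h2] at h1
      exact mul_left_cancel₀ (by positivity) h1

theorem map_purityRV (ψ₀ : BipartiteSpace 2 2) (h : ‖ψ₀‖ = 1) :
    Measure.map (purityRV ψ₀) (haarUnitary (Fin 2 × Fin 2)) =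
      Measure.map (fun u : ℝ => (1 + u ^ 2) / 2) schmidtGapLaw := by
  have hm := (continuous_purityRV ψ₀).measurable
  have hg : Measurable fun u : ℝ => (1 + u ^ 2) / 2 := by fun_prop
  have : IsProbabilityMeasure (Measure.map (purityRV ψ₀) (haarUnitary (Fin 2 × Fin 2))) :=
    Measure.isProbabilityMeasure_map hm.aemeasurable
  have : IsProbabilityMeasure (Measure.map (fun u : ℝ => (1 + u ^ 2) / 2) schmidtGapLaw) :=
    Measure.isProbabilityMeasure_map hg.aemeasurable
  obtain ⟨C, hC⟩ := isCompact_univ.exists_bound_of_continuousOn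
    (continuous_purityRV ψ₀).continuousOn
  refine ext_of_forall_integral_pow_eq (a := -max C 1) (b := max C 1) ?_ ?_ fun k => ?_
  · refine (ae_map_iff hm.aemeasurable measurableSet_Icc).2 (.of_forall fun U => ?_)
    have := (hC U trivial).trans (le_max_left C 1)
    rwa [Real.norm_eq_abs, abs_le] at this
  · refine (ae_map_iff hg.aemeasurable measurableSet_Icc).2 ?_
    refine (withDensity_absolutelyContinuous _ _).ae_le ?_
    refine (ae_restrict_mem measurableSet_Ioo).mono fun u hu => ?_
    have h1 := le_max_right C 1
    constructor <;> nlinarith [hu.1, hu.2]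
  · rw [integral_map hm.aemeasurable (by fun_prop), integral_map hg.aemeasurable (by fun_prop)]
    exact integral_purityRV_pow ψ₀ h k

theorem map_spreadRV_qubits (ψ₀ : BipartiteSpace 2 2) (h : ‖ψ₀‖ = 1) :
    Measure.map (spreadRV ψ₀) (haarUnitary (Fin 2 × Fin 2)) =
      Measure.map (fun u : ℝ => u ^ 2 * (1 - u ^ 2) / 4) schmidtGapLaw := by
  have hs : spreadRV ψ₀ = (fun x : ℝ => (3 * x - 1) / 2 - x ^ 2) ∘ purityRV ψ₀ := by
    funext U
    rw [← Complex.ofReal_inj, ofReal_spreadRV, Function.comp_apply]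
    push_cast
    rw [ofReal_purityRV, map_sub, map_pow, eval_powerTrace_three_of_qubits ψ₀ h]
  rw [hs, ← Measure.map_map (by fun_prop) (continuous_purityRV ψ₀).measurable, map_purityRV ψ₀ h,
    Measure.map_map (by fun_prop) (by fun_prop)]
  congr 1
  funext u
  simp only [Function.comp_apply]
  ring

/-! ### Two qubits: the density of the spread. -/

/-- Change of variables for `u ↦ u ^ 2 * (1 - u ^ 2) / 4` on an interval where it has the inverse
`r`. -/
theorem lintegral_schmidtGap_branch {I S : Set ℝ} (hI : MeasurableSet I) (hS : MeasurableSet S)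
    (r : ℝ → ℝ) (hI0 : ∀ u ∈ I, 0 < u) (hIc : ∀ u ∈ I, 1 - 2 * u ^ 2 ≠ 0)
    (hmap : ∀ u ∈ I, u ^ 2 * (1 - u ^ 2) / 4 ∈ Set.Ioo (0 : ℝ) (1 / 16))
    (hrI : ∀ y ∈ Set.Ioo (0 : ℝ) (1 / 16), r y ∈ I)
    (hleft : ∀ u ∈ I, r (u ^ 2 * (1 - u ^ 2) / 4) = u)
    (hright : ∀ y ∈ Set.Ioo (0 : ℝ) (1 / 16), r y ^ 2 * (1 - r y ^ 2) / 4 = y) :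
    ∫⁻ u in I ∩ (fun u : ℝ => u ^ 2 * (1 - u ^ 2) / 4) ⁻¹' S, ENNReal.ofReal (3 * u ^ 2) =
      ∫⁻ y in Set.Ioo (0 : ℝ) (1 / 16) ∩ S, ENNReal.ofReal (6 * r y / √(1 - 16 * y)) := by
  have himg : (fun u : ℝ => u ^ 2 * (1 - u ^ 2) / 4) '' I = Set.Ioo (0 : ℝ) (1 / 16) := by
    ext y
    constructor
    · rintro ⟨u, hu, rfl⟩
      exact hmap u hu
    · exact fun hy => ⟨r y, hrI y hy, hright y hy⟩
  have hg : Measurable fun u : ℝ => u ^ 2 * (1 - u ^ 2) / 4 := by fun_prop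
  have hd : ∀ u : ℝ, HasDerivAt (fun u : ℝ => u ^ 2 * (1 - u ^ 2) / 4)
      (u * (1 - 2 * u ^ 2) / 2) u := fun u => by
    refine (((hasDerivAt_pow 2 u).mul ((hasDerivAt_pow 2 u).const_sub 1)).div_const 4).congr_deriv
      ?_
    push_cast
    ring
  rw [← himg, ← Set.image_inter_preimage, lintegral_image_eq_lintegral_abs_deriv_mul
    (hI.inter (hg hS)) (fun u _ => (hd u).hasDerivWithinAt)]
  · refine setLIntegral_congr_fun (hI.inter (hg hS)) fun u hu => ?_
    have h0 := hI0 u hu.1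
    have hc := hIc u hu.1
    simp only [hleft u hu.1]
    -- The Jacobian is `u |1 - 2u²| / 2` and `√(1 - 16 y) = |1 - 2u²|`, so the product with `6 u /
    -- √(1 - 16 y)` is `3 u²`.
    rw [← ENNReal.ofReal_mul (abs_nonneg _),
      show 1 - 16 * (u ^ 2 * (1 - u ^ 2) / 4) = (1 - 2 * u ^ 2) ^ 2 by ring, Real.sqrt_sq_eq_abs,
      abs_div, abs_mul, abs_of_pos h0, abs_two]
    congr 1
    have := abs_ne_zero.2 hc
    generalize |1 - 2 * u ^ 2| = t at *
    field_simp
    norm_num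
  · exact (fun u hu w hw h => by
      rw [← hleft u hu.1, ← hleft w hw.1]
      exact congrArg r h)

theorem twoQubitDensity_eq {f : ℝ} (hf : f ∈ Set.Ioo (0 : ℝ) (1 / 16)) :
    twoQubitDensity f = 6 * √((1 - √(1 - 16 * f)) / 2) / √(1 - 16 * f) +
      6 * √((1 + √(1 - 16 * f)) / 2) / √(1 - 16 * f) := by
  have h0 : 0 < 1 - 16 * f := by linarith [hf.2]
  set s := √(1 - 16 * f) with hs
  have hs0 : 0 < s := Real.sqrt_pos.2 h0
  have hs2 : 1 - 16 * f = s ^ 2 := (Real.sq_sqrt h0.le).symm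
  have hs1 : s ≤ 1 := by
    rw [hs, Real.sqrt_le_one]
    linarith [hf.1]
  have h2 : √2 * √2 = 2 := Real.mul_self_sqrt (by norm_num)
  have h2' : √2 ≠ 0 := by positivity
  rw [twoQubitDensity, ← hs, show (s - 1) * (16 * f - 1) = s ^ 2 * (1 - s) by
    linear_combination (1 - s) * hs2, hs2, Real.sqrt_mul (sq_nonneg s), Real.sqrt_sq hs0.le,
    show 1 / s + 1 / s ^ 2 = (1 + s) / s ^ 2 by field_simp; ring, Real.sqrt_div (by positivity),
    Real.sqrt_sq hs0.le, Real.sqrt_div (by linarith), Real.sqrt_div (by positivity)]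
  field_simp
  linear_combination 3 * h2

theorem map_schmidtGapLaw :
    Measure.map (fun u : ℝ => u ^ 2 * (1 - u ^ 2) / 4) schmidtGapLaw =
      (volume.restrict (Set.Ioo (0 : ℝ) (1 / 16))).withDensity
        (fun f => ENNReal.ofReal (twoQubitDensity f)) := by
  have hg : Measurable fun u : ℝ => u ^ 2 * (1 - u ^ 2) / 4 := by fun_prop
  -- The critical point of `u² (1 - u²) / 4`, where the maximum `1/16` is attained. The inverses on
  -- its two sides are the roots `u² = (1 ∓ √(1 - 16 y)) / 2`.
  set c : ℝ := √(1 / 2) with hc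
  have hc2 : c ^ 2 = 1 / 2 := Real.sq_sqrt (by norm_num)
  have hc0 : 0 < c := Real.sqrt_pos.2 (by norm_num)
  have hc1 : c < 1 := by nlinarith
  have hsplit : volume.restrict (Set.Ioo (0 : ℝ) 1) =
      volume.restrict (Set.Ioo 0 c) + volume.restrict (Set.Ioo c 1) := by
    rw [← Set.Ioo_union_Ico_eq_Ioo hc0 hc1.le, Measure.restrict_union _ measurableSet_Ico,
      Measure.restrict_congr_set (Ioo_ae_eq_Ico (a := c) (b := (1 : ℝ))).symm]
    exact Set.disjoint_left.2 fun x hx hx' => absurd hx.2 (not_lt.2 hx'.1)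
  have hsq : ∀ y ∈ Set.Ioo (0 : ℝ) (1 / 16), √(1 - 16 * y) ∈ Set.Ioo (0 : ℝ) 1 ∧
      √(1 - 16 * y) ^ 2 = 1 - 16 * y := fun y hy => by
    have h0 : 0 < 1 - 16 * y := by linarith [hy.2]
    refine ⟨⟨Real.sqrt_pos.2 h0, ?_⟩, Real.sq_sqrt h0.le⟩
    rw [Real.sqrt_lt' one_pos]
    linarith [hy.1]
  have hmem : ∀ u : ℝ, u ∈ Set.Ioo (0 : ℝ) 1 → 1 - 2 * u ^ 2 ≠ 0 →
      u ^ 2 * (1 - u ^ 2) / 4 ∈ Set.Ioo (0 : ℝ) (1 / 16) := fun u hu hne => by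
    have h1 := pow_pos (mul_self_pos.2 hne) 1
    have h2 : 0 < u ^ 2 := pow_pos hu.1 2
    have h3 : u ^ 2 < 1 := by nlinarith [hu.1, hu.2]
    constructor
    · have := mul_pos h2 (sub_pos.2 h3)
      linarith
    · nlinarith
  have hroot : ∀ u : ℝ, √(1 - 16 * (u ^ 2 * (1 - u ^ 2) / 4)) = |1 - 2 * u ^ 2| := fun u => by
    rw [show 1 - 16 * (u ^ 2 * (1 - u ^ 2) / 4) = (1 - 2 * u ^ 2) ^ 2 by ring, Real.sqrt_sq_eq_abs]
  have hlow : ∀ u ∈ Set.Ioo 0 c, 0 < 1 - 2 * u ^ 2 := fun u hu => by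
    nlinarith [hu.1, hu.2]
  have hhigh : ∀ u ∈ Set.Ioo c 1, 1 - 2 * u ^ 2 < 0 := fun u hu => by
    nlinarith [hu.1, hu.2]
  ext S hS
  rw [Measure.map_apply hg hS, schmidtGapLaw, withDensity_apply _ (hg hS), hsplit,
    Measure.restrict_add, lintegral_add_measure, Measure.restrict_restrict (hg hS),
    Measure.restrict_restrict (hg hS), Set.inter_comm _ (Set.Ioo 0 c),
    Set.inter_comm _ (Set.Ioo c 1), withDensity_apply _ hS, Measure.restrict_restrict hS,
    Set.inter_comm S,
    lintegral_schmidtGap_branch measurableSet_Ioo hS (fun y => √((1 - √(1 - 16 * y)) / 2)),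
    lintegral_schmidtGap_branch measurableSet_Ioo hS (fun y => √((1 + √(1 - 16 * y)) / 2)),
    ← lintegral_add_left (by fun_prop)]
  · refine setLIntegral_congr_fun (measurableSet_Ioo.inter hS) fun y hy => ?_
    rw [twoQubitDensity_eq hy.1, ENNReal.ofReal_add (by positivity) (by positivity)]
  · exact fun u hu => hc0.trans hu.1
  · exact fun u hu => (hhigh u hu).ne
  · exact fun u hu => hmem u ⟨hc0.trans hu.1, hu.2⟩ (hhigh u hu).ne
  · intro y hy
    obtain ⟨⟨h0, h1⟩, -⟩ := hsq y hy
    constructor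
    · exact Real.sqrt_lt_sqrt (by norm_num) (by linarith)
    · rw [Real.sqrt_lt' one_pos]
      linarith
  · intro u hu
    rw [hroot, abs_of_neg (hhigh u hu), show (1 + -(1 - 2 * u ^ 2)) / 2 = u ^ 2 by ring,
      Real.sqrt_sq (hc0.trans hu.1).le]
  · intro y hy
    obtain ⟨⟨h0, h1⟩, h2⟩ := hsq y hy
    rw [Real.sq_sqrt (by linarith)]
    linear_combination -h2 / 16
  · exact fun u hu => hu.1
  · exact fun u hu => (hlow u hu).ne'
  · exact fun u hu => hmem u ⟨hu.1, hu.2.trans hc1⟩ (hlow u hu).ne'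
  · intro y hy
    obtain ⟨⟨h0, h1⟩, -⟩ := hsq y hy
    constructor
    · exact Real.sqrt_pos.2 (by linarith)
    · exact Real.sqrt_lt_sqrt (by linarith) (by linarith)
  · intro u hu
    rw [hroot, abs_of_pos (hlow u hu), show (1 - (1 - 2 * u ^ 2)) / 2 = u ^ 2 by ring,
      Real.sqrt_sq hu.1.le]
  · intro y hy
    obtain ⟨⟨h0, h1⟩, h2⟩ := hsq y hy
    rw [Real.sq_sqrt (by linarith)]
    linear_combination -h2 / 16

theorem mainTheorem3 :
    -- exact mean and variance, for all dimensions and every fiducial state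
    (∀ (dA dB : ℕ) (ψ₀ : BipartiteSpace dA dB), ‖ψ₀‖ = 1 →
      MemLp (spreadRV ψ₀) 2 (haarUnitary (Fin dA × Fin dB)) ∧
      spreadMean ψ₀ =
        ((dA : ℝ) ^ 2 - 1) * ((dB : ℝ) ^ 2 - 1) /
          (((dA : ℝ) * dB + 1) * ((dA : ℝ) * dB + 2) * ((dA : ℝ) * dB + 3)) ∧
      spreadVariance ψ₀ =
        ((dA : ℝ) ^ 2 - 1) * ((dB : ℝ) ^ 2 - 1) * variancePoly dA dB /
          (((dA : ℝ) * dB + 1) ^ 2 * ((dA : ℝ) * dB + 2) ^ 2 * ((dA : ℝ) * dB + 3) ^ 2 *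
            ((dA : ℝ) * dB + 4) * ((dA : ℝ) * dB + 5) * ((dA : ℝ) * dB + 6) *
            ((dA : ℝ) * dB + 7))) ∧
    -- the mean is of order `1/d`, uniformly in the two dimensions
    (∃ c C : ℝ, 0 < c ∧ 0 < C ∧
      ∀ (dA dB : ℕ) (ψ₀ : BipartiteSpace dA dB), 2 ≤ dA → 2 ≤ dB → ‖ψ₀‖ = 1 →
        c / ((dA : ℝ) * dB) ≤ spreadMean ψ₀ ∧ spreadMean ψ₀ ≤ C / ((dA : ℝ) * dB)) ∧
    -- the variance is of order `1/d³`: the lower bound is uniform in the two dimensions,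
    -- the upper bound is uniform as long as their ratios are bounded by `κ`
    (∃ c : ℝ, 0 < c ∧ ∀ κ : ℝ, 1 ≤ κ → ∃ C : ℝ, 0 < C ∧
      ∀ (dA dB : ℕ) (ψ₀ : BipartiteSpace dA dB), 2 ≤ dA → 2 ≤ dB → ‖ψ₀‖ = 1 →
        c / ((dA : ℝ) * dB) ^ 3 ≤ spreadVariance ψ₀ ∧
        ((dA : ℝ) ≤ κ * dB → (dB : ℝ) ≤ κ * dA →
          spreadVariance ψ₀ ≤ C / ((dA : ℝ) * dB) ^ 3)) ∧
    -- the law of the spread for two qubits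
    (∀ ψ₀ : BipartiteSpace 2 2, ‖ψ₀‖ = 1 →
      Measure.map (spreadRV ψ₀) (haarUnitary (Fin 2 × Fin 2)) =
        (volume.restrict (Set.Ioo (0 : ℝ) (1 / 16))).withDensity
          (fun f => ENNReal.ofReal (twoQubitDensity f))) := by
  refine ⟨fun dA dB ψ₀ h => ⟨memLp_spreadRV ψ₀, spreadMean_eq ψ₀ h, spreadVariance_eq ψ₀ h⟩,
    ⟨1 / 10, 1, by norm_num, one_pos, fun dA dB ψ₀ hA hB h => ?_⟩,
    ⟨1 / 200000, by norm_num, fun κ hκ => ⟨46 * κ, by positivity, fun dA dB ψ₀ hA hB h => ?_⟩⟩,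
    fun ψ₀ h => (map_spreadRV_qubits ψ₀ h).trans map_schmidtGapLaw⟩
  · rw [spreadMean_eq ψ₀ h]
    exact mean_bounds (by exact_mod_cast hA) (by exact_mod_cast hB)
  · rw [spreadVariance_eq ψ₀ h]
    have hv := variance_bounds (a := dA) (b := dB) (by exact_mod_cast hA) (by exact_mod_cast hB)
    exact ⟨hv.1, hv.2 κ hκ⟩
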